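/- Let $f(t)=\pi^2/4-\arccos(t/2)^2$ for $0\le t\le 2$ and $f(t)=0$ for $-2\le t<0$. Restricted to $[-1,1]$, $f$ belongs to $W^{1,\infty}([-1,1])$. Let $\phi$ be either the Gaussian $\phi(x)=\exp(-x^2)$ or the logistic function $\phi(x)=(1+\exp(-x))^{-1}$, let $1\le q\le\infty$, and put $\alpha=1/\min(q,2)$. There are $b\in\mathbb R$ with $\phi^{(k)}(b)\ne0$ for all $k\in\mathbb N_0$; fix any such $b$ and any $\delta>0$. For $m\ge1$ define the following. * $f^*(t)=f(2\cos t)$ with Fourier coefficients $\widehat{f^*}(k)=\frac1{2\pi}\int_{-\pi}^{\pi}f^*(t)e^{-ikt}\,dt$, and the de la Vallée Poussin coefficients $V_0=\widehat{f^*}(0)$, $V_k=2\widehat{f^*}(k)$ for $1\le k\le m$, $V_k=2\,\frac{2m-k+1}{m+1}\,\widehat{f^*}(k)$ for $m+1\le k\le 2m$. * $\tau_{k,p}$ are the coefficients of the polynomial $T_k(x)=\sum_{p\le k}\tau_{k,p}x^p$ with $T_k(2\cos t)=\cos(kt)$. * $M_m>0$ is any constant such that for all $0\le p\le 2m$, $0<h\le\delta/(3m)$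 and $x\in[-1,1]$, $$\Big|(2h)^{-p}\sum_{r=0}^p(-1)^{p-r}\binom pr\phi\big(h(2r-p)x+b\big)-\phi^{(p)}(b)\,x^p\Big|\le M_m h^2;$$ such constants exist. * $h_m=\min\Big\{\frac{\delta}{3m},\ \Big(\max_{0\le k\le 2m}m^{1+\alpha}M_m\sum_{p=0}^k|\phi^{(p)}(b)|^{-1}|\tau_{k,p}|\Big)^{-1/2}\Big\}$. * $$f_m(x)=\sum_{0\le r\le p\le k\le 2m}a^{(m)}_{k,p,r}\,\phi\big(h_m(2r-p)x+b\big),\qquad a^{(m)}_{k,p,r}=V_k\,\tau_{k,p}\,\phi^{(p)}(b)^{-1}(2h_m)^{-p}(-1)^{p-r}\binom pr .$$ Then: 1. (Width.) For every $N\ge1$, $f_N$ is realized on $\mathbb R$ by a network $x\mapsto\sum_{i=1}^n w^2_i\,\phi(w^1_ix+\beta^1_i)+\beta^2$ with a single hidden layer of width $n=4N+1$. 2. (Error.) There is a constant $C$ with $\|f-f_N\|_{L^q([-1,1])}\le C\,N^{-1}$ for all $N\ge1$. 3. (Growth of the parameters.) There is $c>1$ such that the parameters of $f_N$ grow as $\Omega(c^N)$,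 both for the parameters of the construction, $$\max_{0\le r\le p\le k\le 2N}\max\big(|a^{(N)}_{k,p,r}|,\ h_N|2r-p|,\ |b|\big)=\Omega(c^N),$$ and for all realizations of width $\mathcal O(N)$: for every $K\in\mathbb N$ there are $\kappa>0$ and $N_0$ such that for all $N\ge N_0$ and $n\le KN$, every parameter vector $\theta=(w^1,\beta^1,w^2,\beta^2)$ of a single-hidden-layer network of width $n$ with activation $\phi$ that realizes $f_N$ on $\mathbb R$ satisfies $\|\theta\|_\infty\ge\kappa c^N$. -/

import Mathlib

open MeasureTheory Filter
open scoped ENNReal NNReal ContDiff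

noncomputable section

namespace ShallowApprox

/-- `f(t) = π²/4 - arccos(t/2)²` for `t ≥ 0` and `f(t) = 0` for `t < 0`. On `[-1,1]` this is the
function to be approximated; on `[-2,2]` it is the extension used to form `f(2 cos t)`. -/
def target (t : ℝ) : ℝ :=
  if 0 ≤ t then Real.pi ^ 2 / 4 - Real.arccos (t / 2) ^ 2 else 0

/-- Membership in the Sobolev space `W^{1,∞}` of the interval `(-1,1)`: essentially bounded, with an
essentially bounded weak derivative. -/
def MemW1Infty (f : ℝ → ℝ) : Prop :=
  MemLp f ∞ (volume.restrict (Set.Ioo (-1 : ℝ) 1)) ∧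
    ∃ g : ℝ → ℝ, MemLp g ∞ (volume.restrict (Set.Ioo (-1 : ℝ) 1)) ∧
      ∀ η : ℝ → ℝ, ContDiff ℝ ∞ η → HasCompactSupport η → tsupport η ⊆ Set.Ioo (-1 : ℝ) 1 →
        ∫ t in Set.Ioo (-1 : ℝ) 1, f t * deriv η t = -∫ t in Set.Ioo (-1 : ℝ) 1, g t * η t

/-- The Gaussian activation function. -/
def gaussian (x : ℝ) : ℝ := Real.exp (-x ^ 2)

/-- The logistic activation function. -/
def logistic (x : ℝ) : ℝ := (1 + Real.exp (-x))⁻¹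

/-! ### Single-hidden-layer networks -/

/-- Parameters `(w¹, β¹, w², β²)` of a fully connected network with one input, one hidden layer of
width `n` and one output. The norm of this type is the maximum of the absolute values of all
parameters. -/
abbrev ShallowParams (n : ℕ) : Type :=
  (Fin n → ℝ) × (Fin n → ℝ) × (Fin n → ℝ) × ℝ

/-- The function `x ↦ ∑ i, w²ᵢ φ(w¹ᵢ x + β¹ᵢ) + β²` realized by given parameters. -/
def realize (φ : ℝ → ℝ) {n : ℕ} (θ : ShallowParams n) (x : ℝ) : ℝ :=
  (∑ i, θ.2.2.1 i * φ (θ.1 i * x + θ.2.1 i)) + θ.2.2.2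

/-! ### The construction of the approximating networks -/

/-- The `k`-th Fourier coefficient `(2π)⁻¹ ∫_{-π}^{π} f*(t) e^{-ikt} dt` of `f*(t) = f(2 cos t)`.
As `f*` is real and even, `e^{-ikt}` may be replaced by `cos (kt)`. -/
def fourierCoeffStar (f : ℝ → ℝ) (k : ℕ) : ℝ :=
  (2 * Real.pi)⁻¹ * ∫ t in (-Real.pi)..Real.pi, f (2 * Real.cos t) * Real.cos (k * t)

/-- The coefficients `V_k(f)`, `0 ≤ k ≤ 2m`, of the de la Vallée Poussin mean of order `m`. -/
def vpCoeff (f : ℝ → ℝ) (m k : ℕ) : ℝ :=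
  if k = 0 then fourierCoeffStar f 0
  else if k ≤ m then 2 * fourierCoeffStar f k
  else 2 * ((2 * (m : ℝ) - k + 1) / (m + 1)) * fourierCoeffStar f k

/-- The coefficient `τ_{k,p}` of `x^p` in the polynomial `T_k` with `T_k(2 cos t) = cos (kt)`, that
is, in the usual Chebyshev polynomial evaluated at `x / 2`. -/
def chebCoeff (k p : ℕ) : ℝ :=
  ((Polynomial.Chebyshev.T ℝ (k : ℤ)).comp (Polynomial.C (1 / 2) * Polynomial.X)).coeff p

/-- The central difference quotient of order `p` and spacing `2h` at `0` of
`w ↦ φ(w x + b)`; it approximates `φ^{(p)}(b) x^p`. -/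
def centralDiff (φ : ℝ → ℝ) (b h : ℝ) (p : ℕ) (x : ℝ) : ℝ :=
  ((2 * h) ^ p)⁻¹ * ∑ r ∈ Finset.range (p + 1),
    (-1 : ℝ) ^ (p - r) * (p.choose r : ℝ) * φ (h * (2 * (r : ℝ) - p) * x + b)

/-- `M` is an approximation constant `M_{φ;m}`: for all orders `p ≤ 2m` and all `0 < h ≤ δ/(3m)`, the
central difference quotients approximate `φ^{(p)}(b) x^p` on `[-1,1]` with error at most `M h²`. -/
def IsDiffConst (φ : ℝ → ℝ) (b δ : ℝ) (m : ℕ) (M : ℝ) : Prop :=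
  0 < M ∧ ∀ p ≤ 2 * m, ∀ h : ℝ, 0 < h → h ≤ δ / (3 * m) → ∀ x ∈ Set.Icc (-1 : ℝ) 1,
    |centralDiff φ b h p x - iteratedDeriv p φ b * x ^ p| ≤ M * h ^ 2

/-- `α = 1 / min(q, 2)`. -/
def alphaExp (q : ℝ≥0∞) : ℝ := ((min q 2).toReal)⁻¹

/-- The step size
`h = min { δ/(3m), (max_{k ≤ 2m} m^{1+α} M ∑_{p ≤ k} |φ^{(p)}(b)|⁻¹ |τ_{k,p}|)^{-1/2} }`. -/
def stepSize (φ : ℝ → ℝ) (b δ : ℝ) (q : ℝ≥0∞) (M : ℝ) (m : ℕ) : ℝ :=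
  min (δ / (3 * m))
    (((Finset.range (2 * m + 1)).sup' Finset.nonempty_range_add_one fun k =>
        (m : ℝ) ^ (1 + alphaExp q) * M *
          ∑ p ∈ Finset.range (k + 1), |iteratedDeriv p φ b|⁻¹ * |chebCoeff k p|) ^ (-(1 / 2) : ℝ))

/-- The outer weight of the neuron `φ(h(2r-p)x + b)` in the summand `(k, p, r)`. -/
def outerWeight (f φ : ℝ → ℝ) (b h : ℝ) (m k p r : ℕ) : ℝ :=
  vpCoeff f m k * chebCoeff k p * (iteratedDeriv p φ b)⁻¹ * ((2 * h) ^ p)⁻¹ *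
    (-1 : ℝ) ^ (p - r) * (p.choose r : ℝ)

/-- The network `f_m`, with step size `h`, as the sum over `0 ≤ r ≤ p ≤ k ≤ 2m`. -/
def network (f φ : ℝ → ℝ) (b h : ℝ) (m : ℕ) (x : ℝ) : ℝ :=
  ∑ k ∈ Finset.range (2 * m + 1), ∑ p ∈ Finset.range (k + 1), ∑ r ∈ Finset.range (p + 1),
    outerWeight f φ b h m k p r * φ (h * (2 * (r : ℝ) - p) * x + b)

/-- The largest absolute value of a parameter displayed in the sum that defines `network`. -/
def paramSup (f φ : ℝ → ℝ) (b h : ℝ) (m : ℕ) : ℝ≥0 :=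
  (Finset.range (2 * m + 1)).sup fun k => (Finset.range (k + 1)).sup fun p =>
    (Finset.range (p + 1)).sup fun r =>
      max ‖outerWeight f φ b h m k p r‖₊ (max ‖h * (2 * (r : ℝ) - p)‖₊ ‖b‖₊)

end ShallowApprox

end

/-!
The target is approximated in two stages, and the size of the parameters is read off from a single
neuron.

*Approximation.* The Fourier coefficients of `f (2 cos t)` are explicit and decay like `k⁻²`; the
Fourier series is summed with the Bernoulli polynomials (`hasSum_target`). Hence the de la Vallée
Poussin means converge uniformly at rate `1 / m` (`abs_target_sub_vp_le`). Such a mean is a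
polynomial `∑ V_k τ_{k,p} x^p`, and `f_m` arises from it by replacing `φ^{(p)}(b) x^p` by a central
difference quotient of `φ`. By Taylor expansion and the vanishing moments of the difference weights
the error is `O(h²)` (`exists_isDiffConst`), and the step size is chosen such that the accumulated
error is `O(1 / m)`, too, because `∑ |V_k|` is bounded (`abs_vp_sub_network_le`).

*Growth.* The neuron `φ (2 m h x + b)` of largest slope occurs in `f_m` only for `k = p = r = 2m`.
Its weight contains the factor `(2h)^{-2m} / φ^{(2m)}(b)`. Analyticity gives
`|φ^{(2m)}(b)| ≤ C R^{2m} (2m)!`, and `h² = O(m⁻³)`, since the approximation constants are bounded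
below by `|φ^{(3)}(b)| / 6` (`IsDiffConst.le`) and the coefficient of `x²` in the Chebyshev
polynomial of order `2m`, rescaled by `x / 2`, is `± m² / 2`. So the weight grows faster than every
exponential (`eventually_le_abs_outerWeight`).

*Realizations.* Neurons of positive slope are linearly independent modulo constants
(`coeff_eq_zero_of_sum_eq_const`). For the Gaussian this follows from the asymptotics at infinity,
for the logistic function from its complex poles. By the symmetry of `φ` every network reduces to
neurons of non-negative slope, so in any realization of `f_m` the outer weights of some of its `n`
neurons sum, up to signs, to the large weight above (`abs_outerWeight_le_of_realize_eq`).
-/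

namespace ShallowApprox

open Topology

/-! ### Taylor expansion and derivatives of analytic functions -/

theorem abs_sub_taylor_le {φ : ℝ → ℝ} (hφ : ContDiff ℝ ∞ φ) (b y : ℝ) (n : ℕ) {K : ℝ}
    (hK : ∀ t ∈ Set.uIcc b (b + y), |iteratedDeriv n φ t| ≤ K) :
    |φ (b + y) - ∑ j ∈ Finset.range n, iteratedDeriv j φ b * y ^ j / (j.factorial : ℝ)|
      ≤ K * |y| ^ n / (n.factorial : ℝ) := by
  rcases n with _ | n
  · simpa using hK (b + y) Set.right_mem_uIcc
  rcases eq_or_ne y 0 with rfl | hy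
  · simp [Finset.sum_range_succ']
  have hne : b ≠ b + y := by simpa using hy
  obtain ⟨t, ht, hlag⟩ := taylor_mean_remainder_lagrange_iteratedDeriv (n := n) hne
    (hφ.of_le (by exact_mod_cast le_top)).contDiffOn
  have htay : taylorWithinEval φ n (Set.uIcc b (b + y)) b (b + y)
      = ∑ j ∈ Finset.range (n + 1), iteratedDeriv j φ b * y ^ j / (j.factorial : ℝ) := by
    rw [taylor_within_apply]
    refine Finset.sum_congr rfl fun j _ => ?_
    rw [iteratedDerivWithin_eq_iteratedDeriv
      (uniqueDiffOn_uIcc hne) (hφ.of_le (by exact_mod_cast le_top)).contDiffAt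
      Set.left_mem_uIcc]
    simp only [add_sub_cancel_left, smul_eq_mul]
    ring
  rw [← htay, hlag, add_sub_cancel_left, abs_div, abs_mul, abs_pow, Nat.abs_cast]
  gcongr
  exact hK t (Set.uIoo_subset_uIcc_self ht)

/-- A smooth function with a vanishing derivative of some order is a polynomial. -/
theorem exists_polynomial_of_iteratedDeriv_eq_zero {φ : ℝ → ℝ} (hφ : ContDiff ℝ ∞ φ) {n : ℕ}
    (h : ∀ x, iteratedDeriv n φ x = 0) : ∃ P : Polynomial ℝ, ∀ x, φ x = P.eval x := by
  refine ⟨∑ j ∈ Finset.range n,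
    Polynomial.C (iteratedDeriv j φ 0 / (j.factorial : ℝ)) * Polynomial.X ^ j, fun x => ?_⟩
  have key := abs_sub_taylor_le hφ 0 x n (K := 0) (fun t _ => by simp [h t])
  rw [zero_mul, zero_div, abs_nonpos_iff, sub_eq_zero, zero_add] at key
  rw [key, Polynomial.eval_finsetSum]
  refine Finset.sum_congr rfl fun j _ => ?_
  simp only [Polynomial.eval_mul, Polynomial.eval_C, Polynomial.eval_pow, Polynomial.eval_X]
  ring

/-- The zero sets of the derivatives are nowhere dense, so a common non-zero exists by Baire. -/
theorem exists_forall_iteratedDeriv_ne_zero {φ : ℝ → ℝ} (hφ : AnalyticOnNhd ℝ φ Set.univ)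
    (hb : ∃ B, ∀ x, |φ x| ≤ B) (hne : ∃ x y, φ x ≠ φ y) :
    ∃ b, ∀ k : ℕ, iteratedDeriv k φ b ≠ 0 := by
  have hsm : ContDiff ℝ ∞ φ := (hφ.analyticOn.contDiff : ContDiff ℝ ∞ φ)
  have hnz : ∀ k : ℕ, ¬ ∀ x, iteratedDeriv k φ x = 0 := by
    intro k hk
    obtain ⟨P, hP⟩ := exists_polynomial_of_iteratedDeriv_eq_zero hsm hk
    obtain ⟨B, hB⟩ := hb
    have hdeg : P.degree ≤ 0 := by
      rw [← Polynomial.isBoundedUnder_abs_atTop_iff]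
      exact isBoundedUnder_of ⟨B, fun x => by rw [← hP]; exact hB x⟩
    obtain ⟨x, y, hxy⟩ := hne
    apply hxy
    rw [hP, hP, Polynomial.eq_C_of_degree_le_zero hdeg]
    simp
  have han : ∀ k : ℕ, AnalyticOnNhd ℝ (iteratedDeriv k φ) Set.univ := by
    intro k
    rw [iteratedDeriv_eq_iterate]
    exact hφ.iterated_deriv k
  have hd : Dense (⋂ k : ℕ, {x | iteratedDeriv k φ x ≠ 0}) := by
    refine dense_iInter_of_isOpen_nat (fun k => ?_) (fun k => ?_)
    · exact isOpen_ne_fun (continuousOn_univ.1 (han k).continuousOn) continuous_const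
    · intro x
      by_contra hx
      have hev : iteratedDeriv k φ =ᶠ[𝓝 x] fun _ => 0 := by
        rw [mem_closure_iff_frequently, not_frequently] at hx
        filter_upwards [hx] with y hy
        simpa using hy
      exact hnz k fun y => congrFun
        ((han k).eq_of_eventuallyEq (fun _ _ => analyticAt_const) hev) y
  obtain ⟨b, hb⟩ := hd.nonempty
  exact ⟨b, fun k => Set.mem_iInter.1 hb k⟩

/-- Cauchy's bound on the derivatives of a real analytic function. -/
theorem exists_abs_iteratedDeriv_le {φ : ℝ → ℝ} {b : ℝ} (hφ : AnalyticAt ℝ φ b) :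
    ∃ C R : ℝ, 0 < C ∧ 0 < R ∧
      ∀ n : ℕ, |iteratedDeriv n φ b| ≤ C * R ^ n * (n.factorial : ℝ) := by
  obtain ⟨r, hr⟩ := hφ.hasFPowerSeriesAt
  obtain ⟨s, hs0, hs⟩ := ENNReal.lt_iff_exists_nnreal_btwn.1 (hr.r_pos.trans_le hr.r_le)
  have hs0' : 0 < s := by exact_mod_cast hs0
  obtain ⟨C, hC, h⟩ :=
    FormalMultilinearSeries.norm_le_div_pow_of_pos_of_lt_radius _ hs0' hs
  refine ⟨C, (s : ℝ)⁻¹, hC, by positivity, fun n => ?_⟩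
  have hn := h n
  rw [FormalMultilinearSeries.ofScalars_norm, norm_div, Real.norm_eq_abs, RCLike.norm_natCast,
    div_le_iff₀ (by positivity)] at hn
  simpa [div_eq_mul_inv] using hn

/-! ### The two activation functions -/

theorem logistic_eq_sigmoid : logistic = Real.sigmoid := rfl

theorem analyticOnNhd_activation {φ : ℝ → ℝ} (h : φ = gaussian ∨ φ = logistic) :
    AnalyticOnNhd ℝ φ Set.univ := by
  rcases h with rfl | rfl
  · intro x _
    have : AnalyticAt ℝ (fun x : ℝ => -x ^ 2) x := by fun_prop
    exact this.rexp
  · exact analyticOnNhd_sigmoid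

theorem contDiff_activation {φ : ℝ → ℝ} (h : φ = gaussian ∨ φ = logistic) :
    ContDiff ℝ ∞ φ := (analyticOnNhd_activation h).analyticOn.contDiff

theorem exists_center_activation {φ : ℝ → ℝ} (h : φ = gaussian ∨ φ = logistic) :
    ∃ b, ∀ k : ℕ, iteratedDeriv k φ b ≠ 0 := by
  refine exists_forall_iteratedDeriv_ne_zero (analyticOnNhd_activation h) ⟨1, fun x => ?_⟩
    ⟨0, 1, ?_⟩
  · rcases h with rfl | rfl
    · simpa [gaussian] using sq_nonneg x
    · rw [logistic_eq_sigmoid, abs_of_pos (Real.sigmoid_pos x)]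
      exact Real.sigmoid_le_one x
  · rcases h with rfl | rfl
    · simpa [gaussian] using (Real.exp_lt_one_iff.2 (by norm_num : (-1 : ℝ) < 0)).ne'
    · rw [logistic_eq_sigmoid]
      exact Real.sigmoid_injective.ne zero_ne_one

/-- A centre at which no derivative vanishes is not the point of symmetry of `φ`. -/
theorem center_ne_zero {φ : ℝ → ℝ} (h : φ = gaussian ∨ φ = logistic) {b : ℝ}
    (hb : ∀ k : ℕ, iteratedDeriv k φ b ≠ 0) : b ≠ 0 := by
  rintro rfl
  rcases h with rfl | rfl
  · apply hb 1
    rw [iteratedDeriv_one]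
    have : HasDerivAt gaussian (Real.exp (-(0:ℝ) ^ 2) * -((2 : ℕ) * (0:ℝ) ^ (2 - 1) * 1)) 0 :=
      (((hasDerivAt_id (0 : ℝ)).pow 2).neg).exp
    simpa using this.deriv
  · apply hb 2
    rw [iteratedDeriv_succ, iteratedDeriv_one, logistic_eq_sigmoid, Real.deriv_sigmoid]
    have h0 := Real.hasDerivAt_sigmoid 0
    have := (h0.mul (h0.const_sub 1)).deriv
    rw [Real.sigmoid_zero] at this
    exact Eq.trans this (by norm_num)

/-! ### Central difference quotients -/

theorem continuous_iteratedDeriv_of_smooth {φ : ℝ → ℝ} (hφ : ContDiff ℝ ∞ φ) (n : ℕ) :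
    Continuous (iteratedDeriv n φ) :=
  hφ.continuous_iteratedDeriv n (WithTop.coe_le_coe.2 le_top)

theorem sum_choose_mul_pow (p j : ℕ) :
    ∑ r ∈ Finset.range (p + 1), (-1 : ℝ) ^ (p - r) * (p.choose r : ℝ) * (2 * (r : ℝ) - p) ^ j
      = 2 ^ j * (fwdDiff 1)^[p] (fun x : ℝ => x ^ j) (-(p : ℝ) / 2) := by
  rw [fwdDiff_iter_eq_sum_shift, Finset.mul_sum]
  refine Finset.sum_congr rfl fun r _ => ?_
  have : (2 * (r : ℝ) - p) = 2 * (-(p : ℝ) / 2 + r • (1 : ℝ)) := by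
    rw [nsmul_eq_mul]; ring
  rw [this, mul_pow, zsmul_eq_mul]
  push_cast
  ring

theorem sum_choose_mul_pow_of_lt {p j : ℕ} (h : j < p) :
    ∑ r ∈ Finset.range (p + 1), (-1 : ℝ) ^ (p - r) * (p.choose r : ℝ) * (2 * (r : ℝ) - p) ^ j
      = 0 := by
  rw [sum_choose_mul_pow, fwdDiff_iter_pow_eq_zero_of_lt h]
  simp

theorem sum_choose_mul_pow_self (p : ℕ) :
    ∑ r ∈ Finset.range (p + 1), (-1 : ℝ) ^ (p - r) * (p.choose r : ℝ) * (2 * (r : ℝ) - p) ^ p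
      = 2 ^ p * (p.factorial : ℝ) := by
  rw [sum_choose_mul_pow, fwdDiff_iter_eq_factorial]
  simp

/-- The moment of order `p + 1` vanishes because the nodes `2 r - p` are symmetric about `0`. -/
theorem sum_choose_mul_pow_succ (p : ℕ) :
    ∑ r ∈ Finset.range (p + 1), (-1 : ℝ) ^ (p - r) * (p.choose r : ℝ) *
      (2 * (r : ℝ) - p) ^ (p + 1) = 0 := by
  set S := ∑ r ∈ Finset.range (p + 1), (-1 : ℝ) ^ (p - r) * (p.choose r : ℝ) *
      (2 * (r : ℝ) - p) ^ (p + 1) with hS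
  have h : S = -S := by
    conv_lhs => rw [hS, ← Finset.sum_flip]
    rw [hS, ← Finset.sum_neg_distrib]
    refine Finset.sum_congr rfl fun r hr => ?_
    have hrp : r ≤ p := Nat.lt_succ_iff.1 (Finset.mem_range.1 hr)
    have hsign : (-1 : ℝ) ^ p = (-1) ^ (p - r) * (-1) ^ r := by
      rw [← pow_add, Nat.sub_add_cancel hrp]
    have hr2 : (-1 : ℝ) ^ r * (-1) ^ r = 1 := by rw [← mul_pow]; simp
    rw [Nat.choose_symm hrp, Nat.sub_sub_self hrp, Nat.cast_sub hrp,
      show (2 * ((p : ℝ) - r) - p) = (-1) * (2 * (r : ℝ) - p) by ring, mul_pow, pow_succ (-1 : ℝ) p,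
      hsign]
    linear_combination (-(p.choose r : ℝ) * (2 * (r : ℝ) - p) ^ (p + 1) * (-1) ^ (p - r)) * hr2
  linarith

/-- Up to order `p + 1` the Taylor expansion of `φ` at `b` contributes exactly `φ^{(p)}(b) x^p` to
the central difference quotient. -/
theorem sum_choose_mul_taylor (φ : ℝ → ℝ) (b : ℝ) {h : ℝ} (hh : 0 < h) (p : ℕ) (x : ℝ) :
    ((2 * h) ^ p)⁻¹ * ∑ r ∈ Finset.range (p + 1), (-1 : ℝ) ^ (p - r) * (p.choose r : ℝ) *
      (∑ j ∈ Finset.range (p + 2),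
        iteratedDeriv j φ b * (h * (2 * (r : ℝ) - p) * x) ^ j / (j.factorial : ℝ))
      = iteratedDeriv p φ b * x ^ p := by
  have hswap : ∑ r ∈ Finset.range (p + 1), (-1 : ℝ) ^ (p - r) * (p.choose r : ℝ) *
      (∑ j ∈ Finset.range (p + 2),
        iteratedDeriv j φ b * (h * (2 * (r : ℝ) - p) * x) ^ j / (j.factorial : ℝ))
      = ∑ j ∈ Finset.range (p + 2), (iteratedDeriv j φ b * (h * x) ^ j / (j.factorial : ℝ)) *
          ∑ r ∈ Finset.range (p + 1), (-1 : ℝ) ^ (p - r) * (p.choose r : ℝ) *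
            (2 * (r : ℝ) - p) ^ j := by
    simp_rw [Finset.mul_sum]
    rw [Finset.sum_comm]
    refine Finset.sum_congr rfl fun j _ => Finset.sum_congr rfl fun r _ => ?_
    rw [mul_pow, mul_pow, mul_pow]
    ring
  rw [hswap, Finset.sum_range_succ, sum_choose_mul_pow_succ, Finset.sum_range_succ,
    sum_choose_mul_pow_self, Finset.sum_eq_zero fun j hj => by
      rw [sum_choose_mul_pow_of_lt (Finset.mem_range.1 hj), mul_zero]]
  have : (p.factorial : ℝ) ≠ 0 := by positivity
  field_simp
  ring

theorem abs_centralDiff_sub_le {φ : ℝ → ℝ} (hφ : ContDiff ℝ ∞ φ) {b δ h x K : ℝ} {p : ℕ}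
    (hh : 0 < h) (hhp : h * p ≤ δ) (hx : x ∈ Set.Icc (-1 : ℝ) 1)
    (hK : ∀ t ∈ Set.Icc (b - δ) (b + δ), |iteratedDeriv (p + 2) φ t| ≤ K) :
    |centralDiff φ b h p x - iteratedDeriv p φ b * x ^ p|
      ≤ K * (p : ℝ) ^ (p + 2) / ((p + 2).factorial : ℝ) * h ^ 2 := by
  have hδ : 0 ≤ δ := le_trans (by positivity) hhp
  have hK0 : 0 ≤ K := (abs_nonneg _).trans (hK b ⟨by linarith, by linarith⟩)
  rw [← sum_choose_mul_taylor φ b hh p x, centralDiff, ← mul_sub, ← Finset.sum_sub_distrib, abs_mul]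
  have hterm : ∀ r ∈ Finset.range (p + 1),
      |(-1 : ℝ) ^ (p - r) * (p.choose r : ℝ) * φ (h * (2 * (r : ℝ) - p) * x + b)
        - (-1 : ℝ) ^ (p - r) * (p.choose r : ℝ) * (∑ j ∈ Finset.range (p + 2),
        iteratedDeriv j φ b * (h * (2 * (r : ℝ) - p) * x) ^ j / (j.factorial : ℝ))|
      ≤ (p.choose r : ℝ) * (K * (h * p) ^ (p + 2) / ((p + 2).factorial : ℝ)) := by
    intro r hr
    have hrp : (r : ℝ) ≤ p := by exact_mod_cast Nat.lt_succ_iff.1 (Finset.mem_range.1 hr)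
    have hr0 : (0 : ℝ) ≤ r := Nat.cast_nonneg r
    set y := h * (2 * (r : ℝ) - p) * x with hy
    have hyle : |y| ≤ h * p := by
      rw [hy, abs_mul, abs_mul, abs_of_pos hh]
      calc h * |2 * (r : ℝ) - p| * |x| ≤ h * p * 1 := by
            gcongr
            · exact abs_le.2 ⟨by linarith, by linarith⟩
            · exact abs_le.2 hx
        _ = h * p := mul_one _
    rw [← mul_sub, abs_mul, abs_mul, abs_pow, abs_neg, abs_one, one_pow, one_mul, Nat.abs_cast,
      add_comm y b]
    gcongr
    refine (abs_sub_taylor_le hφ b y (p + 2) (K := K) fun t ht => hK t ?_).trans (by gcongr)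
    obtain ⟨hy1, hy2⟩ := abs_le.1 (hyle.trans hhp)
    refine Set.uIcc_subset_Icc ⟨by linarith, by linarith⟩ ⟨by linarith, by linarith⟩ ht
  calc _ ≤ |((2 * h) ^ p)⁻¹| * ∑ r ∈ Finset.range (p + 1),
        (p.choose r : ℝ) * (K * (h * p) ^ (p + 2) / ((p + 2).factorial : ℝ)) := by
        gcongr
        exact (Finset.abs_sum_le_sum_abs _ _).trans (Finset.sum_le_sum hterm)
    _ = _ := by
        rw [← Finset.sum_mul, abs_of_pos (by positivity)]
        have : (∑ r ∈ Finset.range (p + 1), (p.choose r : ℝ)) = 2 ^ p := by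
          exact_mod_cast Nat.sum_range_choose p
        rw [this, mul_pow, mul_pow, pow_add h p 2]
        field_simp

theorem exists_isDiffConst {φ : ℝ → ℝ} (hφ : ContDiff ℝ ∞ φ) (b : ℝ) {δ : ℝ} (hδ : 0 < δ)
    {m : ℕ} (hm : 1 ≤ m) : ∃ M, IsDiffConst φ b δ m M := by
  have hbd : ∀ p : ℕ, ∃ K, ∀ t ∈ Set.Icc (b - δ) (b + δ), |iteratedDeriv (p + 2) φ t| ≤ K := by
    intro p
    have hc : Continuous (iteratedDeriv (p + 2) φ) :=
      continuous_iteratedDeriv_of_smooth hφ _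
    exact isCompact_Icc.exists_bound_of_continuousOn hc.continuousOn
  choose K hK using hbd
  have hK0 : ∀ p, 0 ≤ K p := fun p =>
    (abs_nonneg _).trans (hK p b ⟨by linarith, by linarith⟩)
  refine ⟨1 + ∑ p ∈ Finset.range (2 * m + 1), K p * (p : ℝ) ^ (p + 2) / ((p + 2).factorial : ℝ),
    ?_, fun p hp h hh hhδ x hx => ?_⟩
  · have : ∀ p ∈ Finset.range (2 * m + 1),
        0 ≤ K p * (p : ℝ) ^ (p + 2) / ((p + 2).factorial : ℝ) := fun p _ => by
      have := hK0 p
      positivity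
    linarith [Finset.sum_nonneg this]
  · have hm' : (1 : ℝ) ≤ m := by exact_mod_cast hm
    have hp' : (p : ℝ) ≤ 2 * m := by exact_mod_cast hp
    have hhp : h * p ≤ δ := by
      have h1 : h * (3 * m) ≤ δ := (le_div_iff₀ (by positivity)).1 hhδ
      nlinarith
    refine (abs_centralDiff_sub_le hφ hh hhp hx (hK p)).trans ?_
    gcongr
    have := Finset.single_le_sum (f := fun p : ℕ =>
      K p * (p : ℝ) ^ (p + 2) / ((p + 2).factorial : ℝ)) (fun p _ => by
        have := hK0 p
        positivity) (Finset.mem_range.2 (Nat.lt_succ_of_le hp))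
    linarith

/-- Letting `h → 0` in the symmetric difference quotient of order one bounds every approximation
constant below, uniformly in `m`. -/
theorem IsDiffConst.le {φ : ℝ → ℝ} (hφ : ContDiff ℝ ∞ φ) {b δ : ℝ} (hδ : 0 < δ)
    {m : ℕ} (hm : 1 ≤ m) {M : ℝ} (hM : IsDiffConst φ b δ m M) :
    |iteratedDeriv 3 φ b| / 6 ≤ M := by
  have hc : Continuous (iteratedDeriv 4 φ) :=
    continuous_iteratedDeriv_of_smooth hφ _
  obtain ⟨K, hK⟩ := (isCompact_Icc (a := b - 1) (b := b + 1)).exists_bound_of_continuousOn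
    hc.continuousOn
  have hpos : 0 < min 1 (δ / (3 * m)) := by
    have : (0 : ℝ) < m := by exact_mod_cast hm
    positivity
  have hev : ∀ᶠ h : ℝ in 𝓝[>] 0, |iteratedDeriv 3 φ b| / 6 ≤ M + K / 24 * h := by
    filter_upwards [Ioo_mem_nhdsGT hpos] with h hh
    obtain ⟨h0, hlt⟩ := hh
    have h1 : h ≤ 1 := hlt.le.trans (min_le_left _ _)
    have key := hM.2 1 (by omega) h h0 (hlt.le.trans (min_le_right _ _)) 1 (by simp)
    have t1 := abs_sub_taylor_le hφ b h 4 (K := K) fun t ht => hK t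
      (Set.uIcc_subset_Icc ⟨by linarith, by linarith⟩ ⟨by linarith, by linarith⟩ ht)
    have t2 := abs_sub_taylor_le hφ b (-h) 4 (K := K) fun t ht => hK t
      (Set.uIcc_subset_Icc ⟨by linarith, by linarith⟩ ⟨by linarith, by linarith⟩ ht)
    simp only [centralDiff, Finset.sum_range_succ, Finset.sum_range_zero] at key
    simp only [Finset.sum_range_succ, Finset.sum_range_zero, abs_neg, abs_of_pos h0] at t1 t2
    norm_num [Nat.factorial] at key t1 t2
    rw [show h + b = b + h by ring, show -h + b = b + -h by ring] at key
    set d1 := deriv φ b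
    set d2 := iteratedDeriv 2 φ b
    set d3 := iteratedDeriv 3 φ b
    set u := φ (b + h)
    set v := φ (b + -h)
    have e : d3 / 3 * h ^ 3 = 2 * h * (h⁻¹ * (1 / 2) * (-v + u) - d1)
        - (u - (φ b + d1 * h + d2 * h ^ 2 / 2 + d3 * h ^ 3 / 6))
        + (v - (φ b + -(d1 * h) + d2 * h ^ 2 / 2 + d3 * (-h) ^ 3 / 6)) := by
      field_simp
      ring
    have habs : |d3| / 3 * h ^ 3 ≤ 2 * h * (M * h ^ 2) + K * h ^ 4 / 24 + K * h ^ 4 / 24 := by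
      calc |d3| / 3 * h ^ 3 = |d3 / 3 * h ^ 3| := by
            rw [abs_mul, abs_div, abs_of_pos (pow_pos h0 3)]
            norm_num
        _ ≤ |2 * h * (h⁻¹ * (1 / 2) * (-v + u) - d1)| + _ + _ := by
            rw [e]
            exact (abs_add_le _ _).trans (add_le_add_left (abs_sub _ _) _)
        _ ≤ _ := by
            rw [abs_mul, abs_of_pos (by positivity : 0 < 2 * h)]
            gcongr
    have h3 : (0 : ℝ) < h ^ 3 := by positivity
    refine le_of_mul_le_mul_right ?_ h3
    linarith
  have hlim : Tendsto (fun h : ℝ => M + K / 24 * h) (𝓝[>] 0) (𝓝 (M + K / 24 * 0)) :=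
    (Continuous.tendsto (by fun_prop) 0).mono_left nhdsWithin_le_nhds
  simpa using ge_of_tendsto hlim hev

/-! ### Fourier expansion of the target function -/

theorem target_two_mul_cos {t : ℝ} (h0 : 0 ≤ t) (hπ : t ≤ Real.pi) :
    target (2 * Real.cos t) = max (Real.pi ^ 2 / 4 - t ^ 2) 0 := by
  have hpi := Real.pi_pos
  unfold target
  rcases le_or_gt t (Real.pi / 2) with h | h
  · have hc : 0 ≤ Real.cos t := Real.cos_nonneg_of_mem_Icc ⟨by linarith, h⟩
    rw [if_pos (by linarith), mul_div_cancel_left₀ _ two_ne_zero, Real.arccos_cos h0 hπ,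
      max_eq_left (by nlinarith)]
  · have hc : Real.cos t < 0 := Real.cos_neg_of_pi_div_two_lt_of_lt h (by linarith)
    rw [if_neg (by linarith), max_eq_right (by nlinarith)]

theorem target_two_mul_cos_of_abs_le {t : ℝ} (h : |t| ≤ Real.pi) :
    target (2 * Real.cos t) = max (Real.pi ^ 2 / 4 - t ^ 2) 0 := by
  rw [← Real.cos_abs, target_two_mul_cos (abs_nonneg t) h, sq_abs]

theorem integral_target_mul_cos (k : ℕ) :
    ∫ t in (-Real.pi)..Real.pi, target (2 * Real.cos t) * Real.cos (k * t)
      = ∫ t in (-(Real.pi / 2))..(Real.pi / 2),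
          (Real.pi ^ 2 / 4 - t ^ 2) * Real.cos (k * t) := by
  have hpi := Real.pi_pos
  have h1 : ∫ t in (-Real.pi)..Real.pi, target (2 * Real.cos t) * Real.cos (k * t)
      = ∫ t in (-Real.pi)..Real.pi, max (Real.pi ^ 2 / 4 - t ^ 2) 0 * Real.cos (k * t) := by
    refine intervalIntegral.integral_congr fun t ht => ?_
    rw [Set.uIcc_of_le (by linarith)] at ht
    rw [target_two_mul_cos_of_abs_le (abs_le.2 ht)]
  have hc : Continuous fun t : ℝ => max (Real.pi ^ 2 / 4 - t ^ 2) 0 * Real.cos (k * t) := by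
    fun_prop
  have hz : ∀ a b : ℝ, a ≤ b → (∀ t ∈ Set.Icc a b, Real.pi / 2 ≤ |t|) →
      ∫ t in a..b, max (Real.pi ^ 2 / 4 - t ^ 2) 0 * Real.cos (k * t) = 0 := by
    intro a b hab h
    rw [intervalIntegral.integral_congr (g := fun _ => (0 : ℝ)) fun t ht => ?_]
    · simp
    rw [Set.uIcc_of_le hab] at ht
    have := h t ht
    simp only
    rw [max_eq_right, zero_mul]
    rw [← sq_abs t]
    nlinarith
  rw [h1, ← intervalIntegral.integral_add_adjacent_intervals
      (hc.intervalIntegrable _ (-(Real.pi / 2))) (hc.intervalIntegrable _ _),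
    ← intervalIntegral.integral_add_adjacent_intervals
      (hc.intervalIntegrable (-(Real.pi / 2)) (Real.pi / 2)) (hc.intervalIntegrable _ _),
    hz (-Real.pi) _ (by linarith) fun t ht => ?_, hz _ Real.pi (by linarith) fun t ht => ?_,
    zero_add, add_zero]
  · refine intervalIntegral.integral_congr fun t ht => ?_
    rw [Set.uIcc_of_le (by linarith)] at ht
    rw [max_eq_left]
    nlinarith [ht.1, ht.2]
  · rw [abs_of_nonneg (by linarith [ht.1])]
    exact ht.1
  · rw [abs_of_nonpos (by linarith [ht.2])]
    linarith [ht.2]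

theorem fourierCoeffStar_target_zero : fourierCoeffStar target 0 = Real.pi ^ 2 / 12 := by
  have hpi := Real.pi_pos
  rw [fourierCoeffStar, integral_target_mul_cos]
  have : ∀ t : ℝ, HasDerivAt (fun t : ℝ => Real.pi ^ 2 / 4 * t - t ^ 3 / 3)
      ((Real.pi ^ 2 / 4 - t ^ 2) * Real.cos ((0 : ℕ) * t)) t := by
    intro t
    have := ((hasDerivAt_id t).const_mul (Real.pi ^ 2 / 4)).sub (((hasDerivAt_id t).pow 3).div_const 3)
    convert! this using 1
    simp
  rw [intervalIntegral.integral_eq_sub_of_hasDerivAt (fun t _ => this t)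
    (Continuous.intervalIntegrable (by fun_prop) _ _)]
  field_simp
  ring

theorem fourierCoeffStar_target {k : ℕ} (hk : k ≠ 0) :
    fourierCoeffStar target k = -Real.cos (k * (Real.pi / 2)) / (k : ℝ) ^ 2
      + 2 * Real.sin (k * (Real.pi / 2)) / (Real.pi * (k : ℝ) ^ 3) := by
  have hpi := Real.pi_pos
  have hk' : (k : ℝ) ≠ 0 := Nat.cast_ne_zero.2 hk
  rw [fourierCoeffStar, integral_target_mul_cos]
  have : ∀ t : ℝ, HasDerivAt (fun t : ℝ => (Real.pi ^ 2 / 4 - t ^ 2) * (Real.sin (k * t) / k)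
      - 2 * t * (Real.cos (k * t) / (k : ℝ) ^ 2) + 2 * Real.sin (k * t) / (k : ℝ) ^ 3)
      ((Real.pi ^ 2 / 4 - t ^ 2) * Real.cos (k * t)) t := by
    intro t
    have hl : HasDerivAt (fun t : ℝ => (k : ℝ) * t) k t := by
      simpa using (hasDerivAt_id t).const_mul (k : ℝ)
    have h1 := (((hasDerivAt_id t).pow 2).const_sub (Real.pi ^ 2 / 4)).mul (hl.sin.div_const (k : ℝ))
    have h2 := ((hasDerivAt_id t).const_mul (2 : ℝ)).mul (hl.cos.div_const ((k : ℝ) ^ 2))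
    have h3 := (hl.sin.const_mul (2 : ℝ)).div_const ((k : ℝ) ^ 3)
    convert! (h1.sub h2).add h3 using 1
    simp
    field_simp
    ring
  rw [intervalIntegral.integral_eq_sub_of_hasDerivAt (fun t _ => this t)
    (Continuous.intervalIntegrable (by fun_prop) _ _)]
  simp only [mul_neg, Real.sin_neg, Real.cos_neg]
  field_simp
  ring

theorem abs_fourierCoeffStar_target_le {k : ℕ} (hk : k ≠ 0) :
    |fourierCoeffStar target k| ≤ 2 * ((k : ℝ) ^ 2)⁻¹ := by
  have hk1 : (1 : ℝ) ≤ k := by exact_mod_cast Nat.one_le_iff_ne_zero.2 hk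
  rw [fourierCoeffStar_target hk]
  refine (abs_add_le _ _).trans ?_
  rw [abs_div, abs_div, abs_neg, abs_mul, abs_of_pos (by positivity : 0 < (k : ℝ) ^ 2),
    abs_of_pos (by positivity : 0 < Real.pi * (k : ℝ) ^ 3), abs_two]
  have h1 : |Real.cos (k * (Real.pi / 2))| / (k : ℝ) ^ 2 ≤ 1 / (k : ℝ) ^ 2 := by
    gcongr
    exact Real.abs_cos_le_one _
  have h2 : 2 * |Real.sin (k * (Real.pi / 2))| / (Real.pi * (k : ℝ) ^ 3)
      ≤ 2 * 1 / (2 * (k : ℝ) ^ 2) := by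
    gcongr
    · exact Real.abs_sin_le_one _
    · exact Real.two_le_pi
    · norm_num
  calc _ ≤ 1 / (k : ℝ) ^ 2 + 2 * 1 / (2 * (k : ℝ) ^ 2) := add_le_add h1 h2
    _ = _ := by field_simp; norm_num

theorem abs_fourierCoeffStar_target_two_mul {m : ℕ} (hm : m ≠ 0) :
    |fourierCoeffStar target (2 * m)| = (4 * (m : ℝ) ^ 2)⁻¹ := by
  have hm' : (m : ℝ) ≠ 0 := Nat.cast_ne_zero.2 hm
  rw [fourierCoeffStar_target (by omega),
    show ((2 * m : ℕ) : ℝ) * (Real.pi / 2) = m * Real.pi by push_cast; ring,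
    Real.sin_nat_mul_pi, Real.cos_nat_mul_pi]
  rw [mul_zero, zero_div, add_zero, abs_div, abs_neg, abs_pow, abs_neg, abs_one, one_pow,
    abs_of_nonneg (by positivity)]
  push_cast
  rw [one_div]
  ring

theorem hasSum_cos_div_sq {x : ℝ} (h0 : 0 ≤ x) (h1 : x ≤ 2 * Real.pi) :
    HasSum (fun k : ℕ => Real.cos (k * x) / (k : ℝ) ^ 2)
      (x ^ 2 / 4 - Real.pi * x / 2 + Real.pi ^ 2 / 6) := by
  have hpi := Real.pi_pos
  have := hasSum_one_div_nat_pow_mul_cos one_ne_zero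
    (x := x / (2 * Real.pi)) ⟨by positivity, (div_le_one (by positivity)).2 h1⟩
  convert! this using 1
  · funext k
    rw [show 2 * Real.pi * k * (x / (2 * Real.pi)) = k * x by field_simp]
    ring
  · have := bernoulliFun_two (x / (2 * Real.pi))
    rw [bernoulliFun] at this
    rw [mul_one, this]
    norm_num [Nat.factorial]
    field_simp
    ring

theorem hasSum_sin_div_cube {x : ℝ} (h0 : 0 ≤ x) (h1 : x ≤ 2 * Real.pi) :
    HasSum (fun k : ℕ => Real.sin (k * x) / (k : ℝ) ^ 3)
      (x ^ 3 / 12 - Real.pi * x ^ 2 / 4 + Real.pi ^ 2 * x / 6) := by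
  have hpi := Real.pi_pos
  have := hasSum_one_div_nat_pow_mul_sin one_ne_zero
    (x := x / (2 * Real.pi)) ⟨by positivity, (div_le_one (by positivity)).2 h1⟩
  convert! this using 1
  · funext k
    rw [show 2 * Real.pi * k * (x / (2 * Real.pi)) = k * x by field_simp]
    ring
  · norm_num [Polynomial.bernoulli_def, Finset.sum_range_succ, Nat.choose, Nat.factorial,
      bernoulli_eq_bernoulli'_of_ne_one]
    field_simp
    ring

theorem hasSum_target {s : ℝ} (h0 : 0 ≤ s) (h1 : s ≤ Real.pi) :
    HasSum (fun k : ℕ => (if k = 0 then 1 else 2) * fourierCoeffStar target k * Real.cos (k * s))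
      (target (2 * Real.cos s)) := by
  have hpi := Real.pi_pos
  have hC := hasSum_cos_div_sq (x := s + Real.pi / 2) (by linarith) (by linarith)
  have hD := hasSum_sin_div_cube (x := s + Real.pi / 2) (by linarith) (by linarith)
  have hC' : HasSum (fun k : ℕ => Real.cos (k * (s - Real.pi / 2)) / (k : ℝ) ^ 2)
      (|s - Real.pi / 2| ^ 2 / 4 - Real.pi * |s - Real.pi / 2| / 2 + Real.pi ^ 2 / 6) := by
    have := hasSum_cos_div_sq (abs_nonneg (s - Real.pi / 2))
      (abs_le.2 ⟨by linarith, by linarith⟩)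
    convert! this using 3 with k
    rw [← Real.cos_abs, abs_mul, Nat.abs_cast]
  have hD' : HasSum (fun k : ℕ => Real.sin (k * (s - Real.pi / 2)) / (k : ℝ) ^ 3)
      ((s - Real.pi / 2) ^ 3 / 12 - Real.pi * ((s - Real.pi / 2) * |s - Real.pi / 2|) / 4
        + Real.pi ^ 2 * (s - Real.pi / 2) / 6) := by
    rcases le_total 0 (s - Real.pi / 2) with h | h
    · convert! hasSum_sin_div_cube h (by linarith) using 1
      rw [abs_of_nonneg h]
      ring
    · convert! (hasSum_sin_div_cube (neg_nonneg.2 h) (by linarith)).neg using 1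
      · funext k
        rw [mul_neg, Real.sin_neg]
        ring
      · rw [abs_of_nonpos h]
        ring
  have hsum := (((hC.add hC').neg).add ((hD.sub hD').mul_left (2 / Real.pi)))
  have h0sum : HasSum (fun k : ℕ => if k = 0 then Real.pi ^ 2 / 12 else 0) (Real.pi ^ 2 / 12) :=
    hasSum_ite_eq 0 _
  convert! h0sum.add hsum using 1
  · funext k
    rcases eq_or_ne k 0 with rfl | hk
    · simp [fourierCoeffStar_target_zero]
    · have hk' : (k : ℝ) ≠ 0 := Nat.cast_ne_zero.2 hk
      simp only [if_neg hk, fourierCoeffStar_target hk, mul_add, mul_sub, Real.cos_add, Real.cos_sub,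
        Real.sin_add, Real.sin_sub]
      field_simp
      ring
  · rw [target_two_mul_cos h0 h1]
    rcases le_total s (Real.pi / 2) with h | h
    · rw [abs_of_nonpos (by linarith), max_eq_left (by nlinarith)]
      field_simp
      ring
    · rw [abs_of_nonneg (by linarith), max_eq_right (by nlinarith)]
      field_simp
      ring

/-! ### De la Vallée Poussin means -/

theorem abs_vpCoeff_target_le {m k : ℕ} (hk : k ≠ 0) (hk2 : k ≤ 2 * m) :
    |vpCoeff target m k| ≤ 4 * ((k : ℝ) ^ 2)⁻¹ := by
  have h := abs_fourierCoeffStar_target_le hk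
  rw [vpCoeff, if_neg hk]
  split_ifs with hm
  · rw [abs_mul, abs_two]
    linarith
  · have hkm : (m : ℝ) + 1 ≤ k := by exact_mod_cast not_le.1 hm
    have hk2' : (k : ℝ) ≤ 2 * m := by exact_mod_cast hk2
    have hm0 : (0 : ℝ) ≤ m := Nat.cast_nonneg m
    have hr0 : 0 ≤ (2 * (m : ℝ) - k + 1) / (m + 1) := div_nonneg (by linarith) (by linarith)
    have hr1 : (2 * (m : ℝ) - k + 1) / (m + 1) ≤ 1 := (div_le_one (by linarith)).2 (by linarith)
    rw [abs_mul, abs_mul, abs_two, abs_of_nonneg hr0]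
    nlinarith [abs_nonneg (fourierCoeffStar target k)]

theorem sum_abs_vpCoeff_target_le (m : ℕ) :
    ∑ k ∈ Finset.range (2 * m + 1), |vpCoeff target m k| ≤ 9 := by
  rw [Finset.range_eq_Ico, Finset.sum_eq_sum_Ico_succ_bot (by omega)]
  have h0 : |vpCoeff target m 0| ≤ 1 := by
    rw [vpCoeff, if_pos rfl, fourierCoeffStar_target_zero, abs_of_nonneg (by positivity)]
    nlinarith [Real.pi_pos, Real.pi_lt_d2]
  have h1 : ∑ k ∈ Finset.Ico (0 + 1) (2 * m + 1), |vpCoeff target m k| ≤ 4 * 2 := by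
    calc _ ≤ ∑ k ∈ Finset.Ioo 0 (2 * m + 1), 4 * ((k : ℝ) ^ 2)⁻¹ := by
          refine Finset.sum_le_sum fun k hk => ?_
          have := Finset.mem_Ico.1 hk
          exact abs_vpCoeff_target_le (by omega) (by omega)
      _ ≤ _ := by
          rw [← Finset.mul_sum]
          have := sum_Ioo_inv_sq_le (α := ℝ) 0 (2 * m + 1)
          norm_num at this
          gcongr
  linarith

/-- The Fourier coefficients decay like `k⁻²`, so the error of the de la Vallée Poussin mean is
bounded by the tail `∑_{k > m} 4 k⁻²`. -/
theorem abs_target_sub_vp_le (m : ℕ) {s : ℝ} (h0 : 0 ≤ s) (h1 : s ≤ Real.pi) :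
    |target (2 * Real.cos s)
      - ∑ k ∈ Finset.range (2 * m + 1), vpCoeff target m k * Real.cos (k * s)|
      ≤ 8 / (m + 1) := by
  set G : ℕ → ℝ := fun k =>
    (if k = 0 then 1 else 2) * fourierCoeffStar target k * Real.cos (k * s) with hG
  set W : ℕ → ℝ := fun k => if k < 2 * m + 1 then vpCoeff target m k * Real.cos (k * s) else 0
    with hW
  have hWsum : HasSum W
      (∑ k ∈ Finset.range (2 * m + 1), vpCoeff target m k * Real.cos (k * s)) := by
    have : ∑ k ∈ Finset.range (2 * m + 1), vpCoeff target m k * Real.cos (k * s)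
        = ∑ k ∈ Finset.range (2 * m + 1), W k :=
      Finset.sum_congr rfl fun k hk => by rw [hW]; simp [Finset.mem_range.1 hk]
    rw [this]
    refine hasSum_sum_of_ne_finset_zero fun k hk => ?_
    rw [hW]
    simp only [Finset.mem_range] at hk
    simp [hk]
  have hlow : ∀ k ≤ m, G k - W k = 0 := by
    intro k hk
    rw [hG, hW]
    simp only [if_pos (show k < 2 * m + 1 by omega), vpCoeff]
    split_ifs <;> simp_all
  have hhigh : ∀ k, m < k → |G k - W k| ≤ 4 * ((k : ℝ) ^ 2)⁻¹ := by
    intro k hk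
    have hk0 : k ≠ 0 := by omega
    have hc := abs_fourierCoeffStar_target_le hk0
    have hcos := Real.abs_cos_le_one (k * s)
    have hmk : (m : ℝ) + 1 ≤ k := by exact_mod_cast hk
    have hm0 : (0 : ℝ) ≤ m := Nat.cast_nonneg m
    -- the multiplier of the mean lies in `[0, 1]`
    have hfac : ∀ lam : ℝ, 0 ≤ lam → lam ≤ 1 →
        |2 * fourierCoeffStar target k * Real.cos (k * s)
          - 2 * lam * fourierCoeffStar target k * Real.cos (k * s)| ≤ 4 * ((k : ℝ) ^ 2)⁻¹ := by
      intro lam hl0 hl1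
      rw [show 2 * fourierCoeffStar target k * Real.cos (k * s)
          - 2 * lam * fourierCoeffStar target k * Real.cos (k * s)
          = (2 * (1 - lam)) * (fourierCoeffStar target k * Real.cos (k * s)) by ring, abs_mul,
        abs_mul (fourierCoeffStar target k), abs_of_nonneg (by linarith)]
      calc 2 * (1 - lam) * (|fourierCoeffStar target k| * |Real.cos (k * s)|)
          ≤ 2 * 1 * (2 * ((k : ℝ) ^ 2)⁻¹ * 1) := by
            gcongr
            linarith
        _ = _ := by ring
    rw [hG, hW]
    simp only [if_neg hk0, vpCoeff, if_neg (not_le.2 hk)]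
    split_ifs with hk2
    · have hk2' : (k : ℝ) ≤ 2 * m := by exact_mod_cast Nat.lt_succ_iff.1 hk2
      exact hfac _ (div_nonneg (by linarith) (by linarith))
        ((div_le_one (by linarith)).2 (by linarith))
    · simpa using hfac 0 le_rfl zero_le_one
  have hlim := ((hasSum_target h0 h1).sub hWsum).tendsto_sum_nat.abs
  refine le_of_tendsto' hlim fun n => ?_
  have hsub : Finset.Ioo m n ⊆ Finset.range n := fun k hk =>
    Finset.mem_range.2 (Finset.mem_Ioo.1 hk).2
  rw [← Finset.sum_subset hsub fun k hk hk' => hlow k (by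
    have := Finset.mem_range.1 hk
    simp only [Finset.mem_Ioo, not_and, not_lt] at hk'
    by_contra hcon
    have := hk' (by omega)
    omega)]
  calc _ ≤ ∑ k ∈ Finset.Ioo m n, 4 * ((k : ℝ) ^ 2)⁻¹ :=
        (Finset.abs_sum_le_sum_abs _ _).trans
          (Finset.sum_le_sum fun k hk => hhigh k (Finset.mem_Ioo.1 hk).1)
    _ ≤ 4 * (2 / (m + 1)) := by
        rw [← Finset.mul_sum]
        gcongr
        exact sum_Ioo_inv_sq_le m n
    _ = _ := by ring

/-! ### Chebyshev coefficients -/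

theorem chebCoeff_eq (k p : ℕ) :
    chebCoeff k p = (Polynomial.Chebyshev.T ℝ (k : ℤ)).coeff p * (1 / 2) ^ p := by
  rw [chebCoeff, Polynomial.comp_C_mul_X_coeff]

theorem chebCoeff_zero_zero : chebCoeff 0 0 = 1 := by
  simp [chebCoeff_eq]

theorem chebCoeff_self {k : ℕ} (hk : k ≠ 0) : chebCoeff k k = 1 / 2 := by
  have h := Polynomial.Chebyshev.leadingCoeff_T (R := ℝ) (k : ℤ)
  rw [Polynomial.leadingCoeff, Polynomial.Chebyshev.natDegree_T] at h
  simp only [Int.natAbs_natCast] at h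
  rw [chebCoeff_eq, h]
  obtain ⟨j, rfl⟩ := Nat.exists_eq_succ_of_ne_zero hk
  simp only [Nat.succ_eq_add_one, Nat.add_sub_cancel, pow_succ, one_div, ← mul_assoc, ← mul_pow]
  norm_num

/-- The coefficient of `x²` in `T_{2m}` is half the second derivative at `0`. -/
theorem abs_chebCoeff_two_mul_two (m : ℕ) : |chebCoeff (2 * m) 2| = (m : ℝ) ^ 2 / 2 := by
  have h := Polynomial.Chebyshev.iterate_derivative_T_eval_zero_recurrence (R := ℝ)
    ((2 * m : ℕ) : ℤ) 0
  have h0 : (Polynomial.Chebyshev.T ℝ ((2 * m : ℕ) : ℤ)).eval 0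
      = (((m : ℤ).negOnePow : ℤ) : ℝ) := by
    push_cast
    exact Polynomial.Chebyshev.T_eval_two_mul_zero (R := ℝ) m
  rw [Function.iterate_zero_apply, h0, ← Polynomial.coeff_zero_eq_eval_zero,
    Polynomial.coeff_iterate_derivative] at h
  simp only [zero_add, Nat.descFactorial_self, nsmul_eq_mul] at h
  have hc : (Polynomial.Chebyshev.T ℝ ((2 * m : ℕ) : ℤ)).coeff 2
      = -(2 * (m : ℝ) ^ 2) * (((m : ℤ).negOnePow : ℤ) : ℝ) := by
    norm_num [Nat.factorial] at h ⊢
    linarith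
  have habs : |(((m : ℤ).negOnePow : ℤ) : ℝ)| = 1 := by
    rw [← Int.cast_abs, Int.abs_negOnePow, Int.cast_one]
  rw [chebCoeff_eq, hc, abs_mul, abs_mul, habs, abs_neg, abs_of_nonneg (by positivity),
    abs_of_nonneg (by positivity)]
  ring

theorem sum_chebCoeff_mul_pow (k : ℕ) (s : ℝ) :
    ∑ p ∈ Finset.range (k + 1), chebCoeff k p * (2 * Real.cos s) ^ p = Real.cos (k * s) := by
  have h := Polynomial.Chebyshev.T_real_cos s (k : ℤ)
  rw [Polynomial.eval_eq_sum_range' (n := k + 1)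
    (by rw [Polynomial.Chebyshev.natDegree_T]; simp)] at h
  rw [← Int.cast_natCast (R := ℝ) k, ← h]
  refine Finset.sum_congr rfl fun p _ => ?_
  rw [chebCoeff_eq, mul_assoc, ← mul_pow]
  congr 2
  ring

/-! ### The step size -/

/-- The weighted `ℓ¹`-norm `∑_{p ≤ k} |φ^{(p)}(b)|⁻¹ |τ_{k,p}|` of the coefficients of `T_k`. -/
noncomputable def chebWeight (φ : ℝ → ℝ) (b : ℝ) (k : ℕ) : ℝ :=
  ∑ p ∈ Finset.range (k + 1), |iteratedDeriv p φ b|⁻¹ * |chebCoeff k p|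

theorem chebWeight_nonneg (φ : ℝ → ℝ) (b : ℝ) (k : ℕ) : 0 ≤ chebWeight φ b k :=
  Finset.sum_nonneg fun _ _ => by positivity

theorem chebWeight_zero_pos {φ : ℝ → ℝ} {b : ℝ} (hb : iteratedDeriv 0 φ b ≠ 0) :
    0 < chebWeight φ b 0 := by
  simpa [chebWeight, chebCoeff_zero_zero] using hb

theorem stepSize_pos {φ : ℝ → ℝ} {b δ : ℝ} (hb : iteratedDeriv 0 φ b ≠ 0) (hδ : 0 < δ) (q : ℝ≥0∞)
    {M : ℝ} (hM : 0 < M) {m : ℕ} (hm : 1 ≤ m) : 0 < stepSize φ b δ q M m := by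
  have hm' : (0 : ℝ) < m := by exact_mod_cast hm
  refine lt_min (by positivity) (Real.rpow_pos_of_pos ?_ _)
  rw [Finset.lt_sup'_iff]
  exact ⟨0, by simp, mul_pos (by positivity) (chebWeight_zero_pos hb)⟩

/-- Squaring the definition of the step size; the exponent `1 + α` is only used through
`m ≤ m^{1 + α}`. -/
theorem stepSize_sq_mul_le {φ : ℝ → ℝ} {b δ : ℝ} (hb : iteratedDeriv 0 φ b ≠ 0) (hδ : 0 < δ)
    (q : ℝ≥0∞) {M : ℝ} (hM : 0 < M) {m k : ℕ} (hm : 1 ≤ m) (hk : k ≤ 2 * m) :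
    chebWeight φ b k * (M * stepSize φ b δ q M m ^ 2) ≤ 1 / m := by
  have hm' : (0 : ℝ) < m := by exact_mod_cast hm
  have hm1 : (1 : ℝ) ≤ m := by exact_mod_cast hm
  have hpos := stepSize_pos hb hδ q hM hm
  set X := (Finset.range (2 * m + 1)).sup' Finset.nonempty_range_add_one fun k =>
        (m : ℝ) ^ (1 + alphaExp q) * M *
          ∑ p ∈ Finset.range (k + 1), |iteratedDeriv p φ b|⁻¹ * |chebCoeff k p| with hX
  have hXpos : 0 < X := by
    rw [hX, Finset.lt_sup'_iff]
    exact ⟨0, by simp, mul_pos (by positivity) (chebWeight_zero_pos hb)⟩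
  have hle : (m : ℝ) ^ (1 + alphaExp q) * M * chebWeight φ b k ≤ X :=
    Finset.le_sup' (fun k => (m : ℝ) ^ (1 + alphaExp q) * M *
          ∑ p ∈ Finset.range (k + 1), |iteratedDeriv p φ b|⁻¹ * |chebCoeff k p|)
      (Finset.mem_range.2 (Nat.lt_succ_of_le hk))
  have hsq : stepSize φ b δ q M m ^ 2 ≤ X⁻¹ := by
    calc stepSize φ b δ q M m ^ 2 ≤ (X ^ (-(1 / 2) : ℝ)) ^ 2 := by
          gcongr
          exact min_le_right _ _
      _ = X⁻¹ := by
          rw [← Real.rpow_natCast, ← Real.rpow_mul hXpos.le]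
          norm_num
          rw [Real.rpow_neg_one]
  have hα : (m : ℝ) ≤ (m : ℝ) ^ (1 + alphaExp q) := by
    have h0 : 0 ≤ alphaExp q := by unfold alphaExp; positivity
    calc (m : ℝ) = (m : ℝ) ^ (1 : ℝ) := (Real.rpow_one _).symm
      _ ≤ _ := Real.rpow_le_rpow_of_exponent_le hm1 (by linarith)
  have hw := chebWeight_nonneg φ b k
  rw [le_div_iff₀ hm']
  calc chebWeight φ b k * (M * stepSize φ b δ q M m ^ 2) * m
      ≤ chebWeight φ b k * (M * X⁻¹) * (m : ℝ) ^ (1 + alphaExp q) := by gcongr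
    _ = ((m : ℝ) ^ (1 + alphaExp q) * M * chebWeight φ b k) * X⁻¹ := by ring
    _ ≤ X * X⁻¹ := by gcongr
    _ = 1 := mul_inv_cancel₀ hXpos.ne'

/-! ### The approximation error -/

theorem network_eq_sum_centralDiff (f φ : ℝ → ℝ) (b h : ℝ) (m : ℕ) (x : ℝ) :
    network f φ b h m x = ∑ k ∈ Finset.range (2 * m + 1), vpCoeff f m k *
      ∑ p ∈ Finset.range (k + 1), chebCoeff k p * (iteratedDeriv p φ b)⁻¹ *
        centralDiff φ b h p x := by
  simp only [network, centralDiff, outerWeight, Finset.mul_sum]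
  refine Finset.sum_congr rfl fun k _ => Finset.sum_congr rfl fun p _ =>
    Finset.sum_congr rfl fun r _ => ?_
  ring

theorem abs_vp_sub_network_le {φ : ℝ → ℝ} {b δ : ℝ} (hb : ∀ k, iteratedDeriv k φ b ≠ 0)
    (hδ : 0 < δ) (q : ℝ≥0∞) {m : ℕ} (hm : 1 ≤ m) {M : ℝ} (hM : IsDiffConst φ b δ m M) {x : ℝ}
    (hx : x ∈ Set.Icc (-1 : ℝ) 1) :
    |(∑ k ∈ Finset.range (2 * m + 1), vpCoeff target m k *
        ∑ p ∈ Finset.range (k + 1), chebCoeff k p * x ^ p)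
      - network target φ b (stepSize φ b δ q M m) m x| ≤ 9 / m := by
  have hm' : (0 : ℝ) < m := by exact_mod_cast hm
  set h := stepSize φ b δ q M m with hh
  have hpos : 0 < h := stepSize_pos (hb 0) hδ q hM.1 hm
  have hhle : h ≤ δ / (3 * m) := min_le_left _ _
  rw [network_eq_sum_centralDiff, ← Finset.sum_sub_distrib]
  calc _ ≤ ∑ k ∈ Finset.range (2 * m + 1), |vpCoeff target m k| * (1 / m) := by
        refine (Finset.abs_sum_le_sum_abs _ _).trans (Finset.sum_le_sum fun k hk => ?_)
        have hk' : k ≤ 2 * m := Nat.lt_succ_iff.1 (Finset.mem_range.1 hk)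
        rw [← mul_sub, abs_mul, ← Finset.sum_sub_distrib]
        refine mul_le_mul_of_nonneg_left ?_ (abs_nonneg _)
        refine le_trans ?_ (stepSize_sq_mul_le (hb 0) hδ q hM.1 hm hk')
        rw [chebWeight, Finset.sum_mul]
        refine (Finset.abs_sum_le_sum_abs _ _).trans (Finset.sum_le_sum fun p hp => ?_)
        have hp' : p ≤ k := Nat.lt_succ_iff.1 (Finset.mem_range.1 hp)
        have hφ := hb p
        have e : chebCoeff k p * x ^ p
            - chebCoeff k p * (iteratedDeriv p φ b)⁻¹ * centralDiff φ b h p x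
            = -(chebCoeff k p * (iteratedDeriv p φ b)⁻¹ *
              (centralDiff φ b h p x - iteratedDeriv p φ b * x ^ p)) := by
          field_simp
          ring
        rw [e, abs_neg, abs_mul, abs_mul, abs_inv, mul_comm |chebCoeff k p|]
        gcongr
        exact hM.2 p (hp'.trans hk') h hpos hhle x hx
    _ ≤ 9 * (1 / m) := by
        rw [← Finset.sum_mul]
        gcongr
        exact sum_abs_vpCoeff_target_le m
    _ = 9 / m := by ring

theorem abs_target_sub_network_le {φ : ℝ → ℝ} {b δ : ℝ} (hb : ∀ k, iteratedDeriv k φ b ≠ 0)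
    (hδ : 0 < δ) (q : ℝ≥0∞) {m : ℕ} (hm : 1 ≤ m) {M : ℝ} (hM : IsDiffConst φ b δ m M) {x : ℝ}
    (hx : x ∈ Set.Icc (-1 : ℝ) 1) :
    |target x - network target φ b (stepSize φ b δ q M m) m x| ≤ 17 / m := by
  have hm' : (0 : ℝ) < m := by exact_mod_cast hm
  have hcos : 2 * Real.cos (Real.arccos (x / 2)) = x := by
    rw [Real.cos_arccos (by linarith [hx.1]) (by linarith [hx.2])]
    ring
  have h1 := abs_target_sub_vp_le m (Real.arccos_nonneg (x / 2)) (Real.arccos_le_pi (x / 2))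
  simp_rw [← sum_chebCoeff_mul_pow, hcos] at h1
  have h2 := abs_vp_sub_network_le hb hδ q hm hM hx
  have h3 : (8 : ℝ) / (m + 1) ≤ 8 / m := by
    gcongr
    linarith
  refine (abs_sub_le _ _ _).trans ((add_le_add (h1.trans h3) h2).trans_eq ?_)
  ring

theorem eLpNorm_target_sub_network_le {φ : ℝ → ℝ} {b δ : ℝ} (hb : ∀ k, iteratedDeriv k φ b ≠ 0)
    (hδ : 0 < δ) {q : ℝ≥0∞} (hq : 1 ≤ q) {m : ℕ} (hm : 1 ≤ m) {M : ℝ}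
    (hM : IsDiffConst φ b δ m M) :
    eLpNorm (fun x => target x - network target φ b (stepSize φ b δ q M m) m x) q
      (volume.restrict (Set.Icc (-1 : ℝ) 1)) ≤ ENNReal.ofReal (34 / m) := by
  have hae : ∀ᵐ x ∂(volume.restrict (Set.Icc (-1 : ℝ) 1)),
      ‖target x - network target φ b (stepSize φ b δ q M m) m x‖ ≤ 17 / m := by
    filter_upwards [ae_restrict_mem measurableSet_Icc] with x hx
    exact abs_target_sub_network_le hb hδ q hm hM hx
  refine (eLpNorm_le_of_ae_bound hae).trans ?_
  have hvol : (volume.restrict (Set.Icc (-1 : ℝ) 1)) Set.univ = 2 := by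
    rw [Measure.restrict_apply_univ, Real.volume_Icc]
    norm_num
  have hexp : q.toReal⁻¹ ≤ 1 := by
    rcases eq_or_ne q ⊤ with rfl | hq'
    · simp
    · exact inv_le_one_of_one_le₀ (by simpa using ENNReal.toReal_mono hq' hq)
  calc _ ≤ (2 : ℝ≥0∞) ^ (1 : ℝ) * ENNReal.ofReal (17 / m) := by
        rw [hvol]
        gcongr
        exact one_le_two
    _ = ENNReal.ofReal (34 / m) := by
        rw [ENNReal.rpow_one, show (34 / m : ℝ) = 2 * (17 / m) by ring,
          ENNReal.ofReal_mul zero_le_two]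
        norm_num

/-! ### Growth of the extremal outer weight -/

theorem abs_outerWeight_target_top (φ : ℝ → ℝ) (b h : ℝ) {m : ℕ} (hm : 1 ≤ m) :
    |outerWeight target φ b h m (2 * m) (2 * m) (2 * m)|
      = (4 * (m : ℝ) ^ 2 * (m + 1) * (|iteratedDeriv (2 * m) φ b| * (4 * h ^ 2) ^ m))⁻¹ := by
  have hm' : (0 : ℝ) < m := by exact_mod_cast hm
  have hV : |vpCoeff target m (2 * m)| = (2 * (m : ℝ) ^ 2 * (m + 1))⁻¹ := by
    rw [vpCoeff, if_neg (by omega), if_neg (by omega), abs_mul, abs_mul,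
      abs_fourierCoeffStar_target_two_mul (by omega)]
    push_cast
    rw [sub_self, zero_add, abs_two, abs_of_pos (by positivity)]
    field_simp
    norm_num
  rw [outerWeight, abs_mul, abs_mul, abs_mul, abs_mul, abs_mul, hV, chebCoeff_self (by omega),
    Nat.sub_self, pow_zero, Nat.choose_self, Nat.cast_one, abs_one, mul_one, mul_one, abs_inv,
    abs_inv, abs_pow, pow_mul, sq_abs, abs_of_pos (by norm_num : (0 : ℝ) < 1 / 2),
    show (2 * h) ^ 2 = 4 * h ^ 2 by ring]
  simp only [mul_inv]
  ring

/-- The coefficient of `x²` in `T_{2m}` has size `m²`, which makes the step size `O(m^{-3/2})`. -/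
theorem exists_stepSize_sq_le {φ : ℝ → ℝ} (hφ : ContDiff ℝ ∞ φ) {b δ : ℝ}
    (hb : ∀ k, iteratedDeriv k φ b ≠ 0) (hδ : 0 < δ) (q : ℝ≥0∞) :
    ∃ D : ℝ, 0 < D ∧ ∀ m : ℕ, 1 ≤ m → ∀ M : ℝ, IsDiffConst φ b δ m M →
      stepSize φ b δ q M m ^ 2 ≤ D / (m : ℝ) ^ 3 := by
  have h2 := abs_pos.2 (hb 2)
  have h3 := abs_pos.2 (hb 3)
  refine ⟨12 * |iteratedDeriv 2 φ b| / |iteratedDeriv 3 φ b|, by positivity,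
    fun m hm M hM => ?_⟩
  have hm' : (0 : ℝ) < m := by exact_mod_cast hm
  have hw : |iteratedDeriv 2 φ b|⁻¹ * ((m : ℝ) ^ 2 / 2) ≤ chebWeight φ b (2 * m) := by
    rw [← abs_chebCoeff_two_mul_two]
    exact Finset.single_le_sum
      (f := fun p => |iteratedDeriv p φ b|⁻¹ * |chebCoeff (2 * m) p|)
      (fun p _ => by positivity) (Finset.mem_range.2 (by omega))
  have key : |iteratedDeriv 2 φ b|⁻¹ * ((m : ℝ) ^ 2 / 2) *
      (|iteratedDeriv 3 φ b| / 6 * stepSize φ b δ q M m ^ 2) ≤ 1 / m :=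
    le_trans (by
      gcongr
      · exact chebWeight_nonneg _ _ _
      · exact hM.le hφ hδ hm) (stepSize_sq_mul_le (hb 0) hδ q hM.1 hm le_rfl)
  have e : stepSize φ b δ q M m ^ 2
      = (|iteratedDeriv 2 φ b|⁻¹ * ((m : ℝ) ^ 2 / 2) *
      (|iteratedDeriv 3 φ b| / 6 * stepSize φ b δ q M m ^ 2)) *
        (12 * |iteratedDeriv 2 φ b| / |iteratedDeriv 3 φ b| / (m : ℝ) ^ 2) := by
    field_simp
    ring
  rw [e]
  calc _ ≤ 1 / (m : ℝ) * (12 * |iteratedDeriv 2 φ b| / |iteratedDeriv 3 φ b| / (m : ℝ) ^ 2) := by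
        gcongr
    _ = _ := by field_simp

/-- The step size is `O(m^{-3/2})` while `|φ^{(2m)}(b)|` is at most `C R^{2m} (2m)!`, so that
the extremal weight grows at least like `(m / E)^m`, faster than any exponential. -/
theorem eventually_le_abs_outerWeight {φ : ℝ → ℝ} (hφ : AnalyticOnNhd ℝ φ Set.univ) {b δ : ℝ}
    (hb : ∀ k, iteratedDeriv k φ b ≠ 0) (hδ : 0 < δ) (q : ℝ≥0∞) {M : ℕ → ℝ}
    (hM : ∀ m : ℕ, 1 ≤ m → IsDiffConst φ b δ m (M m)) {L : ℝ} (hL : 0 < L) :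
    ∀ᶠ N : ℕ in atTop, L * N * 2 ^ N ≤
      |outerWeight target φ b (stepSize φ b δ q (M N) N) N (2 * N) (2 * N) (2 * N)| := by
  have hsm : ContDiff ℝ ∞ φ := hφ.analyticOn.contDiff
  obtain ⟨C, R, hC, hR, hder⟩ := exists_abs_iteratedDeriv_le (hφ b (Set.mem_univ b))
  obtain ⟨D, hD, hstep⟩ := exists_stepSize_sq_le hsm hb hδ q
  set E := 16 * R ^ 2 * D with hE
  have hlim : Tendsto (fun N : ℕ => 8 * C * L * ((N : ℝ) ^ 4 * (1 / 2) ^ N)) atTop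
      (𝓝 (8 * C * L * 0)) :=
    (tendsto_pow_const_mul_const_pow_of_abs_lt_one 4 (by norm_num [abs_of_pos])).const_mul _
  rw [mul_zero] at hlim
  filter_upwards [hlim.eventually_le_const zero_lt_one, eventually_ge_atTop 1,
    eventually_ge_atTop ⌈4 * E⌉₊] with N hN1 hN hNE
  have hN' : (1 : ℝ) ≤ N := by exact_mod_cast hN
  have hN0 : (0 : ℝ) < N := by linarith
  have hNE' : 4 * E ≤ N := (Nat.le_ceil _).trans (by exact_mod_cast hNE)
  set h := stepSize φ b δ q (M N) N with hh
  have hpos : 0 < h := stepSize_pos (hb 0) hδ q (hM N hN).1 hN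
  have hderpos := abs_pos.2 (hb (2 * N))
  have hfact : ((2 * N).factorial : ℝ) ≤ (4 * (N : ℝ) ^ 2) ^ N := by
    have : ((2 * N).factorial : ℝ) ≤ ((2 * N : ℕ) : ℝ) ^ (2 * N) := by
      exact_mod_cast Nat.factorial_le_pow (2 * N)
    refine this.trans_eq ?_
    rw [pow_mul]
    push_cast
    ring
  have hprod : |iteratedDeriv (2 * N) φ b| * (4 * h ^ 2) ^ N ≤ C * (1 / 4) ^ N := by
    calc |iteratedDeriv (2 * N) φ b| * (4 * h ^ 2) ^ N
        ≤ (C * R ^ (2 * N) * (4 * (N : ℝ) ^ 2) ^ N) * (4 * (D / (N : ℝ) ^ 3)) ^ N := by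
          gcongr
          · exact (hder _).trans (by gcongr)
          · exact hstep N hN (M N) (hM N hN)
      _ = C * (E / N) ^ N := by
          rw [pow_mul, mul_assoc C, mul_assoc C, ← mul_pow, ← mul_pow, hE]
          congr 2
          field_simp
          ring
      _ ≤ C * (1 / 4) ^ N := by
          have hEN : E / N ≤ 1 / 4 := by
            rw [div_le_div_iff₀ hN0 (by norm_num)]
            linarith
          have hE0 : 0 ≤ E / N := by positivity
          exact mul_le_mul_of_nonneg_left (pow_le_pow_left₀ hE0 hEN N) hC.le
  rw [abs_outerWeight_target_top φ b h hN, le_inv_comm₀ (by positivity) (by positivity)]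
  calc 4 * (N : ℝ) ^ 2 * (N + 1) * (|iteratedDeriv (2 * N) φ b| * (4 * h ^ 2) ^ N)
      ≤ 4 * (N : ℝ) ^ 2 * (N + N) * (C * (1 / 4) ^ N) := by gcongr
    _ = (8 * C * L * ((N : ℝ) ^ 4 * (1 / 2) ^ N)) * (L * N * 2 ^ N)⁻¹ := by
        rw [show (1 / 4 : ℝ) = 1 / 2 * 2⁻¹ by norm_num, mul_pow, inv_pow]
        field_simp
        ring
    _ ≤ 1 * (L * N * 2 ^ N)⁻¹ := by gcongr
    _ = _ := one_mul _

theorem abs_outerWeight_le_paramSup (f φ : ℝ → ℝ) (b h : ℝ) {m k p r : ℕ} (hk : k ≤ 2 * m)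
    (hp : p ≤ k) (hr : r ≤ p) : |outerWeight f φ b h m k p r| ≤ (paramSup f φ b h m : ℝ) := by
  have h1 : ‖outerWeight f φ b h m k p r‖₊ ≤ paramSup f φ b h m := by
    unfold paramSup
    refine le_trans ?_ (Finset.le_sup (Finset.mem_range.2 (Nat.lt_succ_of_le hk)))
    refine le_trans ?_ (Finset.le_sup (Finset.mem_range.2 (Nat.lt_succ_of_le hp)))
    refine le_trans ?_ (Finset.le_sup (Finset.mem_range.2 (Nat.lt_succ_of_le hr)))
    exact le_max_left _ _
  exact_mod_cast h1

/-! ### Linear independence of the neurons -/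

/-- A Gaussian neuron is negligible at infinity against one with lexicographically smaller
parameters. -/
theorem tendsto_exp_sq_sub_sq {s t : ℝ × ℝ} (hs : 0 < s.1) (hlt : toLex s < toLex t) :
    Tendsto (fun x : ℝ => Real.exp ((s.1 * x + s.2) ^ 2 - (t.1 * x + t.2) ^ 2)) atTop (𝓝 0) := by
  refine Real.tendsto_exp_atBot.comp ?_
  have hadd : ∀ a b : ℝ, 0 < a → Tendsto (fun x : ℝ => a * x + b) atTop atTop := fun a b ha =>
    tendsto_atTop_add_const_right _ _ (tendsto_id.const_mul_atTop ha)
  rcases Prod.Lex.toLex_lt_toLex.1 hlt with h1 | ⟨h1, h2⟩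
  · have hA := hadd (t.1 - s.1) (t.2 - s.2) (sub_pos.2 h1)
    have hB := hadd (s.1 + t.1) (s.2 + t.2) (by linarith)
    refine (tendsto_neg_atTop_atBot.comp (hA.atTop_mul_atTop₀ hB)).congr fun x => ?_
    simp only [Function.comp_apply]
    ring
  · have hB := hadd (s.1 + t.1) (s.2 + t.2) (by linarith)
    refine (tendsto_neg_atTop_atBot.comp (hB.const_mul_atTop (sub_pos.2 h2))).congr fun x => ?_
    simp only [Function.comp_apply]
    rw [h1]
    ring

/-- At infinity a combination of Gaussian neurons tends to `0`, and it is asymptotic to its term with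
the lexicographically smallest parameters. -/
theorem gaussian_sum_ne_const {S : Finset (ℝ × ℝ)} (hS : S.Nonempty) (hpos : ∀ s ∈ S, 0 < s.1)
    {c : ℝ × ℝ → ℝ} (hc : ∀ s ∈ S, c s ≠ 0) (d : ℝ) :
    ¬ ∀ x, ∑ s ∈ S, c s * gaussian (s.1 * x + s.2) = d := by
  intro h
  have hd : d = 0 := by
    have hlim : Tendsto (fun x : ℝ => ∑ s ∈ S, c s * gaussian (s.1 * x + s.2)) atTop
        (𝓝 (∑ s ∈ S, c s * 0)) := by
      refine tendsto_finsetSum _ fun s hs => Tendsto.const_mul _ ?_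
      refine Real.tendsto_exp_atBot.comp (tendsto_neg_atTop_atBot.comp ?_)
      exact (tendsto_pow_atTop two_ne_zero).comp (tendsto_atTop_add_const_right _ _
        (tendsto_id.const_mul_atTop (hpos s hs)))
    simp only [h, mul_zero, Finset.sum_const_zero] at hlim
    exact tendsto_nhds_unique tendsto_const_nhds hlim
  obtain ⟨s₀, hs₀, hmin⟩ := S.exists_min_image (fun s => toLex s) hS
  have hlim : Tendsto (fun x : ℝ => ∑ s ∈ S,
      c s * Real.exp ((s₀.1 * x + s₀.2) ^ 2 - (s.1 * x + s.2) ^ 2)) atTop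
      (𝓝 (∑ s ∈ S, c s * if s = s₀ then 1 else 0)) := by
    refine tendsto_finsetSum _ fun s hs => Tendsto.const_mul _ ?_
    split_ifs with heq
    · subst heq
      simp
    · exact tendsto_exp_sq_sub_sq (hpos s₀ hs₀)
        (lt_of_le_of_ne (hmin s hs) fun hh => heq (toLex.injective hh).symm)
  have hzero : ∀ x : ℝ, ∑ s ∈ S,
      c s * Real.exp ((s₀.1 * x + s₀.2) ^ 2 - (s.1 * x + s.2) ^ 2) = 0 := by
    intro x
    rw [← mul_zero (Real.exp ((s₀.1 * x + s₀.2) ^ 2)), ← hd, ← h x, Finset.mul_sum]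
    refine Finset.sum_congr rfl fun s _ => ?_
    rw [gaussian, sub_eq_add_neg, Real.exp_add]
    ring
  simp only [hzero] at hlim
  have := tendsto_nhds_unique tendsto_const_nhds hlim
  simp only [mul_ite, mul_one, mul_zero, Finset.sum_ite_eq', if_pos hs₀] at this
  exact hc s₀ hs₀ this.symm

/-- Clearing denominators turns a linear relation between logistic neurons into the vanishing of
an entire function on `ℝ`, hence on `ℂ`. At the pole nearest to the real axis of a neuron of largest
slope only the term of that neuron survives. -/
theorem logistic_sum_ne_const {S : Finset (ℝ × ℝ)} (hS : S.Nonempty) (hpos : ∀ s ∈ S, 0 < s.1)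
    {c : ℝ × ℝ → ℝ} (hc : ∀ s ∈ S, c s ≠ 0) (d : ℝ) :
    ¬ ∀ x, ∑ s ∈ S, c s * logistic (s.1 * x + s.2) = d := by
  intro h
  obtain ⟨s₀, hs₀, hmax⟩ := S.exists_max_image (fun s => s.1) hS
  set E : ℝ × ℝ → ℂ → ℂ := fun s z => 1 + Complex.exp (-((s.1 : ℂ) * z + s.2)) with hE
  set F : ℂ → ℂ := fun z => ∑ s ∈ S, (c s : ℂ) * ∏ t ∈ S.erase s, E t z - d * ∏ t ∈ S, E t z
    with hF
  have hdiff : Differentiable ℂ F := by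
    have hEd : ∀ t, Differentiable ℂ (E t) := fun t => by
      simp only [hE]
      fun_prop
    refine Differentiable.sub (Differentiable.fun_sum fun s _ => ?_) ?_
    · exact (Differentiable.fun_finsetProd fun t _ => hEd t).const_mul _
    · exact (Differentiable.fun_finsetProd fun t _ => hEd t).const_mul _
  have hreal : ∀ x : ℝ, F x = 0 := by
    intro x
    have hEx : ∀ s : ℝ × ℝ, E s x = ((1 + Real.exp (-(s.1 * x + s.2)) : ℝ) : ℂ) := fun s => by
      simp [hE]
    have hne : ∀ s : ℝ × ℝ, E s x ≠ 0 := fun s => by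
      rw [hEx]
      exact_mod_cast (by positivity : (1 + Real.exp (-(s.1 * x + s.2))) ≠ 0)
    have hx : (d : ℂ) = ∑ s ∈ S, (c s : ℂ) * (E s x)⁻¹ := by
      rw [← h x]
      push_cast
      refine Finset.sum_congr rfl fun s _ => ?_
      rw [hEx, logistic]
      push_cast
      rfl
    simp only [hF]
    rw [hx, Finset.sum_mul, sub_eq_zero]
    refine Finset.sum_congr rfl fun s hs => ?_
    rw [← Finset.mul_prod_erase S (fun t => E t x) hs, mul_assoc, inv_mul_cancel_left₀ (hne s)]
  have hzero : F = fun _ => 0 := by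
    refine AnalyticOnNhd.eq_of_frequently_eq (z₀ := ((0 : ℝ) : ℂ))
      (fun z _ => hdiff.analyticAt z) (fun z _ => analyticAt_const) ?_
    have ht : Tendsto (fun x : ℝ => (x : ℂ)) (𝓝[≠] 0) (𝓝[≠] ((0 : ℝ) : ℂ)) :=
      tendsto_nhdsWithin_of_tendsto_nhds_of_eventually_within _
        (Complex.continuous_ofReal.continuousAt.mono_left nhdsWithin_le_nhds)
        (eventually_nhdsWithin_of_forall fun x hx => by simpa using hx)
    exact ht.frequently (Eventually.of_forall hreal).frequently
  have hw₀ := hpos s₀ hs₀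
  have hw₀' : (s₀.1 : ℂ) ≠ 0 := by exact_mod_cast hw₀.ne'
  set z₀ : ℂ := (-s₀.2 + Real.pi * Complex.I) / s₀.1 with hz₀
  have hz : (s₀.1 : ℂ) * z₀ = -s₀.2 + Real.pi * Complex.I := by
    rw [hz₀, mul_div_cancel₀ _ hw₀']
  have hE₀ : E s₀ z₀ = 0 := by
    simp only [hE]
    rw [hz, neg_add_cancel_comm, Complex.exp_neg, Complex.exp_pi_mul_I]
    norm_num
  have hEne : ∀ t ∈ S.erase s₀, E t z₀ ≠ 0 := by
    intro t ht h0
    obtain ⟨htne, htS⟩ := Finset.mem_erase.1 ht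
    have hexp : Complex.exp (-((t.1 : ℂ) * z₀ + t.2)) = Complex.exp (Real.pi * Complex.I) := by
      rw [Complex.exp_pi_mul_I]
      exact eq_neg_of_add_eq_zero_right h0
    obtain ⟨n, hn⟩ := Complex.exp_eq_exp_iff_exists_int.1 hexp
    have hre : z₀.re = -s₀.2 / s₀.1 := by
      rw [hz₀, Complex.div_ofReal_re]
      simp
    have him : z₀.im = Real.pi / s₀.1 := by
      rw [hz₀, Complex.div_ofReal_im]
      simp
    have h1 := congrArg Complex.re hn
    have h2 := congrArg Complex.im hn
    simp [hre, him] at h1 h2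
    have hpi := Real.pi_pos
    have h3 : -t.1 = (1 + 2 * n) * s₀.1 := by
      field_simp at h2
      linarith
    have ht0 := hpos t htS
    have htm := hmax t htS
    -- as `0 < t.1 ≤ s₀.1`, the odd number `1 + 2 n` lies in `[-1, 0)`
    have hn1 : n = -1 := by
      have ha : (n : ℝ) < 0 := by
        by_contra hcon
        nlinarith [not_lt.1 hcon]
      have hb : (-2 : ℝ) < n := by
        by_contra hcon
        nlinarith [not_lt.1 hcon]
      have ha' : n < 0 := by exact_mod_cast ha
      have hb' : -2 < n := by exact_mod_cast hb
      omega
    have h4 : t.1 = s₀.1 := by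
      rw [hn1] at h3
      push_cast at h3
      linarith
    refine htne (Prod.ext h4 ?_)
    rw [h4] at h1
    field_simp at h1
    linarith
  have hval := congrFun hzero z₀
  simp only [hF] at hval
  rw [Finset.prod_eq_zero hs₀ hE₀, mul_zero, sub_zero, Finset.sum_eq_single_of_mem s₀ hs₀
    fun s hs hne => by
      rw [Finset.prod_eq_zero (Finset.mem_erase.2 ⟨hne.symm, hs₀⟩) hE₀, mul_zero]] at hval
  rcases mul_eq_zero.1 hval with h0 | h0
  · exact hc s₀ hs₀ (by exact_mod_cast h0)
  · obtain ⟨t, ht, ht0⟩ := Finset.prod_eq_zero_iff.1 h0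
    exact hEne t ht ht0

/-- The neurons `x ↦ φ (w x + β)` with slope `w > 0` are linearly independent modulo constants; the
neurons of slope `0` are constant. -/
theorem coeff_eq_zero_of_sum_eq_const {φ : ℝ → ℝ} (hφ : φ = gaussian ∨ φ = logistic)
    {c : ℝ × ℝ →₀ ℝ} (hsupp : c ∈ Finsupp.supported ℝ ℝ {s : ℝ × ℝ | 0 ≤ s.1}) {d : ℝ}
    (h : ∀ x, Finsupp.linearCombination ℝ (fun (s : ℝ × ℝ) (x : ℝ) => φ (s.1 * x + s.2)) c x = d)
    {s : ℝ × ℝ} (hs : 0 < s.1) : c s = 0 := by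
  by_contra hcs
  set S := c.support.filter fun t => 0 < t.1 with hSdef
  have hS : S.Nonempty := ⟨s, by simp [hSdef, hcs, hs]⟩
  have hpos : ∀ t ∈ S, 0 < t.1 := fun t ht => (Finset.mem_filter.1 ht).2
  have hne : ∀ t ∈ S, c t ≠ 0 := fun t ht => Finsupp.mem_support_iff.1 (Finset.mem_filter.1 ht).1
  have hsum : ∀ x, ∑ t ∈ S, c t * φ (t.1 * x + t.2)
      = d - ∑ t ∈ c.support with ¬ 0 < t.1, c t * φ t.2 := by
    intro x
    rw [← h x, Finsupp.linearCombination_apply, Finsupp.sum, Finset.sum_apply, eq_sub_iff_add_eq,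
      ← Finset.sum_filter_add_sum_filter_not c.support fun t => 0 < t.1]
    congr 1
    refine Finset.sum_congr rfl fun t ht => ?_
    obtain ⟨ht1, ht2⟩ := Finset.mem_filter.1 ht
    have ht0 : t.1 = 0 := le_antisymm (not_lt.1 ht2) (hsupp ht1)
    simp [ht0]
  rcases hφ with rfl | rfl
  · exact gaussian_sum_ne_const hS hpos hne _ hsum
  · exact logistic_sum_ne_const hS hpos hne _ hsum

/-! ### All realizations of the network -/

/-- The neuron `x ↦ a φ (w x + β)` as a formal combination of neurons of non-negative slope, for an
activation with `φ (-x) = ε φ x + const`; the constant is dropped. -/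
noncomputable def neuronCoeff (ε w β a : ℝ) : ℝ × ℝ →₀ ℝ :=
  if w < 0 then Finsupp.single (-w, -β) (ε * a) else Finsupp.single (w, β) a

theorem neuronCoeff_mem_supported (ε w β a : ℝ) :
    neuronCoeff ε w β a ∈ Finsupp.supported ℝ ℝ {s : ℝ × ℝ | 0 ≤ s.1} := by
  unfold neuronCoeff
  split_ifs with h
  · exact Finsupp.single_mem_supported ℝ _ (by simpa using h.le)
  · exact Finsupp.single_mem_supported ℝ _ (by simpa using h)

theorem abs_neuronCoeff_apply_le {ε : ℝ} (hε : |ε| = 1) (w β a : ℝ) (s : ℝ × ℝ) :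
    |neuronCoeff ε w β a s| ≤ |a| := by
  classical
  unfold neuronCoeff
  split_ifs with h <;> rw [Finsupp.single_apply] <;> split_ifs <;> simp [abs_mul, hε]

theorem linearCombination_neuronCoeff {φ : ℝ → ℝ} {ε d : ℝ} (hε : |ε| = 1)
    (hsymm : ∀ x, φ (-x) = ε * φ x + d) (w β a x : ℝ) :
    Finsupp.linearCombination ℝ (fun (s : ℝ × ℝ) (x : ℝ) => φ (s.1 * x + s.2))
      (neuronCoeff ε w β a) x = a * φ (w * x + β) + if w < 0 then ε * a * d else 0 := by
  have hε2 : ε * ε = 1 := by rw [← abs_mul_abs_self, hε, one_mul]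
  unfold neuronCoeff
  split_ifs with h
  · rw [Finsupp.linearCombination_single, Pi.smul_apply, smul_eq_mul]
    simp only
    rw [show -w * x + -β = -(w * x + β) by ring, hsymm]
    linear_combination a * φ (w * x + β) * hε2
  · rw [Finsupp.linearCombination_single, Pi.smul_apply, smul_eq_mul, add_zero]

theorem exists_symm_activation {φ : ℝ → ℝ} (h : φ = gaussian ∨ φ = logistic) :
    ∃ ε d : ℝ, |ε| = 1 ∧ ∀ x, φ (-x) = ε * φ x + d := by
  rcases h with rfl | rfl
  · exact ⟨1, 0, abs_one, fun x => by simp [gaussian]⟩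
  · refine ⟨-1, 1, by simp, fun x => ?_⟩
    rw [logistic_eq_sigmoid, Real.sigmoid_neg]
    ring

/-- The index set `0 ≤ r ≤ p ≤ k ≤ 2m` of the neurons of `network`. -/
def networkIndex (m : ℕ) : Finset (Σ _ : ℕ, Σ _ : ℕ, ℕ) :=
  (Finset.range (2 * m + 1)).sigma fun k => (Finset.range (k + 1)).sigma fun p =>
    Finset.range (p + 1)

theorem mem_networkIndex {m : ℕ} {t : Σ _ : ℕ, Σ _ : ℕ, ℕ} :
    t ∈ networkIndex m ↔ t.1 ≤ 2 * m ∧ t.2.1 ≤ t.1 ∧ t.2.2 ≤ t.2.1 := by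
  simp [networkIndex]

theorem network_eq_sum_networkIndex (f φ : ℝ → ℝ) (b h : ℝ) (m : ℕ) (x : ℝ) :
    network f φ b h m x = ∑ t ∈ networkIndex m, outerWeight f φ b h m t.1 t.2.1 t.2.2 *
      φ (h * (2 * (t.2.2 : ℝ) - t.2.1) * x + b) := by
  simp only [network, networkIndex, Finset.sum_sigma]

/-- The inner weights `h (2r - p)` only depend on `2r - p ∈ [-2m, 2m]`; the neuron `i` of the network
collects the terms with `2r - p = i - 2m`. -/
theorem exists_realize_eq_network (f φ : ℝ → ℝ) (b h : ℝ) (m : ℕ) :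
    ∃ θ : ShallowParams (4 * m + 1), realize φ θ = network f φ b h m := by
  refine ⟨(fun i => h * ((i : ℕ) - 2 * m), fun _ => b, fun i => ∑ t ∈ networkIndex m,
    if 2 * t.2.2 + 2 * m = i + t.2.1 then outerWeight f φ b h m t.1 t.2.1 t.2.2 else 0, 0), ?_⟩
  funext x
  rw [network_eq_sum_networkIndex, realize, add_zero]
  simp only [Finset.sum_mul]
  rw [Finset.sum_comm]
  refine Finset.sum_congr rfl fun t ht => ?_
  obtain ⟨h1, h2, h3⟩ := mem_networkIndex.1 ht
  have hi : 2 * t.2.2 + 2 * m - t.2.1 < 4 * m + 1 := by omega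
  rw [Finset.sum_eq_single_of_mem (⟨2 * t.2.2 + 2 * m - t.2.1, hi⟩ : Fin (4 * m + 1))
    (Finset.mem_univ _) fun i _ hne => ?_]
  · simp only
    rw [if_pos (by omega), Nat.cast_sub (by omega)]
    push_cast
    congr 3
    ring
  · rw [if_neg, zero_mul]
    intro heq
    exact hne (Fin.ext (by simp only; omega))

/-- Comparing coefficients, every network that realizes `f_m` has to reproduce the weight of the
neuron of largest slope, which comes from the single index `k = p = r = 2m`. Here `b ≠ 0` keeps this
neuron apart from the one of opposite slope. -/
theorem abs_outerWeight_le_of_realize_eq {φ : ℝ → ℝ} (hφ : φ = gaussian ∨ φ = logistic) {b h : ℝ}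
    (hb : b ≠ 0) (hh : 0 < h) (f : ℝ → ℝ) {m n : ℕ} (hm : 1 ≤ m) {θ : ShallowParams n}
    (hθ : realize φ θ = network f φ b h m) :
    |outerWeight f φ b h m (2 * m) (2 * m) (2 * m)| ≤ n * ‖θ‖ := by
  classical
  obtain ⟨ε, d, hε, hsymm⟩ := exists_symm_activation hφ
  have hm' : (0 : ℝ) < m := by exact_mod_cast hm
  set c₁ : ℝ × ℝ →₀ ℝ := ∑ i, neuronCoeff ε (θ.1 i) (θ.2.1 i) (θ.2.2.1 i) with hc₁
  set c₂ : ℝ × ℝ →₀ ℝ := ∑ t ∈ networkIndex m, neuronCoeff ε (h * (2 * (t.2.2 : ℝ) - t.2.1)) b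
    (outerWeight f φ b h m t.1 t.2.1 t.2.2) with hc₂
  set s : ℝ × ℝ := (h * (2 * m), b) with hs
  have hs0 : 0 < s.1 := by
    simp only [hs]
    positivity
  have heq : c₁ s = c₂ s := by
    rw [← sub_eq_zero, ← Finsupp.sub_apply]
    refine coeff_eq_zero_of_sum_eq_const hφ (d := (∑ i, if θ.1 i < 0 then ε * θ.2.2.1 i * d else 0)
      - θ.2.2.2 - ∑ t ∈ networkIndex m, if h * (2 * (t.2.2 : ℝ) - t.2.1) < 0 then
        ε * outerWeight f φ b h m t.1 t.2.1 t.2.2 * d else 0) ?_ (fun x => ?_) hs0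
    · exact sub_mem (sum_mem fun i _ => neuronCoeff_mem_supported _ _ _ _)
        (sum_mem fun t _ => neuronCoeff_mem_supported _ _ _ _)
    · have hx := congrFun hθ x
      rw [network_eq_sum_networkIndex, realize] at hx
      rw [map_sub, hc₁, hc₂, map_sum, map_sum, Pi.sub_apply, Finset.sum_apply, Finset.sum_apply]
      simp only [linearCombination_neuronCoeff hε hsymm, Finset.sum_add_distrib]
      linarith
  have h₂ : c₂ s = outerWeight f φ b h m (2 * m) (2 * m) (2 * m) := by
    rw [hc₂, Finsupp.finsetSum_apply, Finset.sum_eq_single_of_mem ⟨2 * m, 2 * m, 2 * m⟩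
      (mem_networkIndex.2 ⟨le_rfl, le_rfl, le_rfl⟩) fun t ht hne => ?_]
    · have e : h * (2 * ((2 * m : ℕ) : ℝ) - ((2 * m : ℕ) : ℝ)) = h * (2 * m) := by
        push_cast
        ring
      simp only
      rw [e, neuronCoeff, if_neg (not_lt.2 hs0.le), Finsupp.single_eq_same]
    · obtain ⟨h1, h2, h3⟩ := mem_networkIndex.1 ht
      unfold neuronCoeff
      split_ifs with hneg
      · refine Finsupp.single_eq_of_ne fun hcon => hb ?_
        have := congrArg Prod.snd hcon
        simp only [hs] at this
        linarith
      · refine Finsupp.single_eq_of_ne fun hcon => hne ?_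
        have h4 := congrArg Prod.fst hcon
        simp only [hs] at h4
        have h5 : (2 : ℝ) * m + t.2.1 = 2 * t.2.2 := by
          have := mul_left_cancel₀ hh.ne' h4
          linarith
        have h6 : 2 * m + t.2.1 = 2 * t.2.2 := by exact_mod_cast h5
        obtain ⟨k, p, r⟩ := t
        simp only at h1 h2 h3 h6
        obtain rfl : k = 2 * m := by omega
        obtain rfl : p = 2 * m := by omega
        obtain rfl : r = 2 * m := by omega
        rfl
  rw [← h₂, ← heq, hc₁, Finsupp.finsetSum_apply]
  calc |∑ i, neuronCoeff ε (θ.1 i) (θ.2.1 i) (θ.2.2.1 i) s| ≤ ∑ _i : Fin n, ‖θ‖ := by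
        refine (Finset.abs_sum_le_sum_abs _ _).trans (Finset.sum_le_sum fun i _ => ?_)
        refine (abs_neuronCoeff_apply_le hε _ _ _ _).trans ?_
        calc |θ.2.2.1 i| ≤ ‖θ.2.2.1‖ := norm_le_pi_norm θ.2.2.1 i
          _ ≤ ‖θ.2.2‖ := norm_fst_le _
          _ ≤ ‖θ.2‖ := norm_snd_le _
          _ ≤ ‖θ‖ := norm_snd_le _
    _ = n * ‖θ‖ := by simp

/-! ### Sobolev regularity of the target function -/

theorem target_of_nonneg {t : ℝ} (h : 0 ≤ t) :
    target t = Real.pi ^ 2 / 4 - Real.arccos (t / 2) ^ 2 := if_pos h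

theorem measurable_target : Measurable target :=
  Measurable.ite measurableSet_Ici
    (((Real.continuous_arccos.measurable.comp (measurable_id.div_const 2)).pow_const 2).const_sub _)
    measurable_const

theorem hasDerivAt_target {t : ℝ} (h1 : -1 < t) (h2 : t < 1) :
    HasDerivAt (fun t : ℝ => Real.pi ^ 2 / 4 - Real.arccos (t / 2) ^ 2)
      (Real.arccos (t / 2) / √(1 - (t / 2) ^ 2)) t := by
  have h := (((Real.hasDerivAt_arccos (x := t / 2) (by linarith) (by linarith)).comp t
    ((hasDerivAt_id t).div_const 2)).pow 2).const_sub (Real.pi ^ 2 / 4)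
  convert! h using 1
  simp
  ring

/-- Integration by parts; the boundary term at `0` vanishes because `target 0 = 0`. -/
theorem integral_target_mul_deriv {η : ℝ → ℝ} (hη : ContDiff ℝ ∞ η) (h1 : η 1 = 0) :
    ∫ t in (0 : ℝ)..1, target t * deriv η t
      = -∫ t in (0 : ℝ)..1, Real.arccos (t / 2) / √(1 - (t / 2) ^ 2) * η t := by
  have hcongr : ∫ t in (0 : ℝ)..1, target t * deriv η t
      = ∫ t in (0 : ℝ)..1, (Real.pi ^ 2 / 4 - Real.arccos (t / 2) ^ 2) * deriv η t := by
    refine intervalIntegral.integral_congr fun t ht => ?_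
    rw [Set.uIcc_of_le zero_le_one] at ht
    rw [target_of_nonneg ht.1]
  have hc : ContinuousOn (fun t : ℝ => Real.arccos (t / 2) / √(1 - (t / 2) ^ 2))
      (Set.uIcc 0 1) := by
    rw [Set.uIcc_of_le zero_le_one]
    refine ContinuousOn.div (by fun_prop) (by fun_prop) fun t ht => ?_
    exact (Real.sqrt_pos.2 (by nlinarith [ht.1, ht.2])).ne'
  have hd : Continuous (deriv η) := hη.continuous_deriv (by simp)
  rw [hcongr, intervalIntegral.integral_mul_deriv_eq_deriv_mul_of_hasDerivAt
    (u' := fun t => Real.arccos (t / 2) / √(1 - (t / 2) ^ 2)) (v := η)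
    (by fun_prop) hη.continuous.continuousOn (fun t ht => ?_) (fun t _ => ?_)
    hc.intervalIntegrable (hd.intervalIntegrable _ _)]
  · simp only [h1, zero_div, Real.arccos_zero]
    ring
  · simp only [zero_le_one, min_eq_left, max_eq_right] at ht
    exact hasDerivAt_target (by linarith [ht.1]) ht.2
  · exact (hη.differentiable (by simp) t).hasDerivAt

/-- The weak derivative is the pointwise one, extended by `0` to the negative half of the interval. -/
theorem memW1Infty_target : MemW1Infty target := by
  have hpi := Real.pi_pos
  refine ⟨memLp_top_of_bound measurable_target.aestronglyMeasurable (Real.pi ^ 2)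
      (Eventually.of_forall fun t => ?_),
    fun t => if 0 ≤ t then Real.arccos (t / 2) / √(1 - (t / 2) ^ 2) else 0, ?_, ?_⟩
  · have h0 := Real.arccos_nonneg (t / 2)
    have h1 := Real.arccos_le_pi (t / 2)
    unfold target
    rw [Real.norm_eq_abs, abs_le]
    split_ifs <;> constructor <;> nlinarith
  · refine memLp_top_of_bound ?_ (2 * Real.pi) ?_
    · refine (Measurable.ite measurableSet_Ici ?_ measurable_const).aestronglyMeasurable
      exact (Real.continuous_arccos.measurable.comp (measurable_id.div_const 2)).div
        (Continuous.measurable (by fun_prop))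
    · filter_upwards [ae_restrict_mem measurableSet_Ioo] with t ht
      have h0 := Real.arccos_nonneg (t / 2)
      have h1 := Real.arccos_le_pi (t / 2)
      split_ifs with hsgn
      · have hs : (1 : ℝ) / 2 ≤ √(1 - (t / 2) ^ 2) :=
          Real.le_sqrt_of_sq_le (by nlinarith [ht.1, ht.2])
        rw [Real.norm_eq_abs, abs_of_nonneg (by positivity), div_le_iff₀ (by linarith)]
        nlinarith
      · simpa using hpi.le
  · intro η hη _ hsupp
    have hη1 : η 1 = 0 := by
      by_contra hne
      exact absurd (hsupp (subset_tsupport _ hne)).2 (lt_irrefl _)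
    have hsplit : ∀ F G : ℝ → ℝ, (∀ t, F t = if 0 ≤ t then G t else 0) →
        ∫ t in Set.Ioo (-1 : ℝ) 1, F t = ∫ t in (0 : ℝ)..1, G t := by
      intro F G hFG
      have hF : F = Set.indicator (Set.Ici 0) G := by
        funext t
        rw [hFG t]
        rfl
      rw [hF, setIntegral_indicator measurableSet_Ici, intervalIntegral.integral_of_le zero_le_one,
        ← integral_Ico_eq_integral_Ioc]
      congr 2
      ext t
      simp only [Set.mem_inter_iff, Set.mem_Ioo, Set.mem_Ici, Set.mem_Ico]
      exact ⟨fun h => ⟨h.2, h.1.2⟩, fun h => ⟨⟨by linarith [h.1], h.2⟩, h.1⟩⟩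
    rw [hsplit (fun t => target t * deriv η t) (fun t => target t * deriv η t) fun t => ?_,
      hsplit _ (fun t => Real.arccos (t / 2) / √(1 - (t / 2) ^ 2) * η t) fun t => ?_,
      integral_target_mul_deriv hη hη1]
    · simp only [ite_mul, zero_mul]
    · unfold target
      split_ifs <;> simp

end ShallowApprox

theorem mainTheorem2 :
    ShallowApprox.MemW1Infty ShallowApprox.target ∧
    ∀ φ : ℝ → ℝ, (φ = ShallowApprox.gaussian ∨ φ = ShallowApprox.logistic) →
      -- admissible centres exist
      (∃ b : ℝ, ∀ k : ℕ, iteratedDeriv k φ b ≠ 0) ∧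
      ∀ b : ℝ, (∀ k : ℕ, iteratedDeriv k φ b ≠ 0) → ∀ δ : ℝ, 0 < δ →
        -- approximation constants exist
        (∀ m : ℕ, 1 ≤ m → ∃ M : ℝ, ShallowApprox.IsDiffConst φ b δ m M) ∧
        ∀ M : ℕ → ℝ, (∀ m : ℕ, 1 ≤ m → ShallowApprox.IsDiffConst φ b δ m (M m)) →
          ∀ q : ℝ≥0∞, 1 ≤ q →
          ∀ h : ℕ → ℝ, (∀ N, h N = ShallowApprox.stepSize φ b δ q (M N) N) →
          ∀ f : ℕ → ℝ → ℝ,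
            (∀ N, f N = ShallowApprox.network ShallowApprox.target φ b (h N) N) →
            -- width of order N
            (∀ N : ℕ, 1 ≤ N → ∃ θ : ShallowApprox.ShallowParams (4 * N + 1),
              ShallowApprox.realize φ θ = f N) ∧
            -- approximation error
            (∃ C : ℝ, ∀ N : ℕ, 1 ≤ N →
              eLpNorm (fun x => ShallowApprox.target x - f N x) q
                (volume.restrict (Set.Icc (-1 : ℝ) 1)) ≤ ENNReal.ofReal (C / N)) ∧
            -- growth of the parameters of the construction, and of all parameters that realize
            -- the same function by a network of width O(N)
            ∃ c : ℝ, 1 < c ∧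
              (∃ κ : ℝ, 0 < κ ∧ ∀ᶠ N : ℕ in atTop,
                κ * c ^ N ≤
                  (ShallowApprox.paramSup ShallowApprox.target φ b (h N) N : ℝ)) ∧
              ∀ K : ℕ, ∃ κ : ℝ, 0 < κ ∧ ∀ᶠ N : ℕ in atTop,
                ∀ n : ℕ, n ≤ K * N → ∀ θ : ShallowApprox.ShallowParams n,
                  ShallowApprox.realize φ θ = f N → κ * c ^ N ≤ ‖θ‖ := by
  refine ⟨ShallowApprox.memW1Infty_target, fun φ hφ =>
    ⟨ShallowApprox.exists_center_activation hφ, fun b hb δ hδ =>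
      ⟨fun m hm => ShallowApprox.exists_isDiffConst (ShallowApprox.contDiff_activation hφ) b hδ hm,
        fun M hM q hq h hh f hf => ?_⟩⟩⟩
  obtain rfl : h = fun N => ShallowApprox.stepSize φ b δ q (M N) N := funext hh
  have hgrow := fun (L : ℝ) (hL : 0 < L) => ShallowApprox.eventually_le_abs_outerWeight
    (ShallowApprox.analyticOnNhd_activation hφ) hb hδ q hM hL
  refine ⟨fun N _ => ?_, ⟨34, fun N hN => ?_⟩, 2, one_lt_two, ⟨1, one_pos, ?_⟩,
    fun K => ⟨1, one_pos, ?_⟩⟩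
  · rw [hf]
    exact ShallowApprox.exists_realize_eq_network _ _ _ _ _
  · simp only [hf]
    exact ShallowApprox.eLpNorm_target_sub_network_le hb hδ hq hN (hM N hN)
  · filter_upwards [hgrow 1 one_pos, eventually_ge_atTop 1] with N hN hN1
    have hN1' : (1 : ℝ) ≤ N := by exact_mod_cast hN1
    have h2 : (0 : ℝ) < 2 ^ N := by positivity
    refine le_trans ?_ (hN.trans
      (ShallowApprox.abs_outerWeight_le_paramSup _ _ _ _ le_rfl le_rfl le_rfl))
    nlinarith
  -- `L = K + 1` absorbs the factor `n ≤ K N` lost in passing from one weight to a sum of `n`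
  · filter_upwards [hgrow (K + 1) (by positivity), eventually_ge_atTop 1] with N hN hN1 n hn θ hθ
    have hN1' : (0 : ℝ) < N := by exact_mod_cast hN1
    have h2 : (0 : ℝ) < 2 ^ N := by positivity
    rw [hf] at hθ
    have hle := hN.trans (ShallowApprox.abs_outerWeight_le_of_realize_eq hφ
      (ShallowApprox.center_ne_zero hφ hb)
      (ShallowApprox.stepSize_pos (hb 0) hδ q (hM N hN1).1 hN1) _ hN1 hθ)
    have hn' : (n : ℝ) ≤ K * N := by exact_mod_cast hn
    by_contra hcon
    have h3 : (n : ℝ) * ‖θ‖ ≤ K * N * 2 ^ N := by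
      gcongr
      linarith
    nlinarith [mul_pos hN1' h2]
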